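/- **Setting.** Let $X$ be a combinatorial graph (loops and multiple edges allowed, connectedness not required) with vertex set $V$ and set $E$ of oriented edges; $\mathfrak o(e),\mathfrak t(e)$ are the origin and terminus of $e\in E$ and $\bar e\neq e$ is the same edge with opposite orientation. Let $\Gamma$ be an amenable discrete group that acts on $X$ by automorphisms, freely on the vertices, with a finite fundamental domain $\mathcal F$: a finite set of cells that contains exactly one vertex of each $\Gamma$-orbit of vertices and a finite set of edges whose translates are all edges. Let $\sigma:E\to U(1)$ satisfy $\sigma(\bar e)=\overline{\sigma(e)}$, be weakly $\Gamma$-invariant (for each $\gamma\in\Gamma$ there is $s_\gamma:V\to U(1)$ with $\sigma(\gamma e)=\sigma(e)\,s_\gamma(\mathfrak t(e))\,\overline{s_\gamma(\mathfrak o(e))}$ for all $e$) and be rational ($\sigma^n=1$ for some integer $n\ge 1$). The discrete magnetic Laplacian is the bounded operator on $\ell^2(V)$ $$(\Delta_\sigma f)(v)=\mathcal O(v)f(v)-\sum_{e\in E,\ \mathfrak t(e)=v}\sigma(e)f(\mathfrak o(e)),$$ where $\mathcal O(v)=\#\{e\in E:\mathfrak t(e)=v\}$ is the valence. **Determinant.**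 For an operator $B$ with matrix $k$ put $\mathrm{Tr}_{\Gamma,\sigma}(B)=\sum_{v\in\mathcal F}k(v,v)$. The spectral density function of a bounded operator $A$ is $G(\lambda)=\mathrm{Tr}_{\Gamma,\sigma}\,\chi_{[0,\lambda]}(|A|)$, $|A|=(A^*A)^{1/2}$, and the Fuglede–Kadison determinant $\det_{\Gamma,\sigma}(A)\ge 0$ is given by $$\log{\det}_{\Gamma,\sigma}(A)=\int_{0<\lambda\le L}\log\lambda\,dG(\lambda)\qquad(L>\|A\|),$$ with $\det_{\Gamma,\sigma}(A)=0$ if the integral is $-\infty$. **Restricted operators.** A regular exhaustion of $\Gamma$ is an increasing sequence of finite subsets $\Lambda_m$ with union $\Gamma$ such that $\#\partial_\delta\Lambda_m/\#\Lambda_m\to 0$ for every $\delta$, where $\partial_\delta\Lambda_m=\{\gamma: d(\gamma,\Lambda_m)<\delta,\ d(\gamma,\Gamma\setminus\Lambda_m)<\delta\}$ and $d$ is the left-invariant word metric of a finite generating set of $\Gamma$. Given one, let $X_m$ be the largest subgraph of $X$ contained in $\bigcup_{\gamma\in\Lambda_m}\gamma\mathcal F$. Let $\Delta_\sigma^{(m)}$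 be the restriction of $\Delta_\sigma$ to the functions on the vertices of $X_m$ with either Dirichlet boundary conditions (the compression $P_m\Delta_\sigma P_m$, where $P_m$ is the projection onto the functions supported on the vertices of $X_m$) or Neumann boundary conditions (the discrete magnetic Laplacian of the finite graph $X_m$ with weight function $\sigma|_{X_m}$). **Proposition.** Let $\mu\in\mathbb C$ satisfy at least one of the following: 1. $\mu\notin\operatorname{spec}\Delta_\sigma$; 2. $\mu=0$; 3. $\mu$ is algebraic and, for some regular exhaustion of $\Gamma$ and one of the two boundary conditions, $\mu\notin\bigcup_m\operatorname{spec}\Delta_\sigma^{(m)}$. Then $\det_{\Gamma,\sigma}(\Delta_\sigma-\mu)>0$. -/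

import Mathlib

open scoped Classical ENNReal lp
open MeasureTheory

noncomputable section

/-! ### Graphs, weight functions and the discrete magnetic Laplacian -/

/-- A locally finite combinatorial graph with vertex set `V` and set of oriented edges `E`:
every combinatorial edge is represented by two distinct oriented edges `e` and `rev e`.
Loops and multiple edges are allowed. -/
structure OrientedGraph (V E : Type*) where
  /-- origin of an oriented edge -/
  o : E → V
  /-- terminus of an oriented edge -/
  t : E → V
  /-- the same edge with the opposite orientation -/
  rev : E → E
  rev_rev : ∀ e, rev (rev e) = e
  rev_ne : ∀ e, rev e ≠ e
  o_rev : ∀ e, o (rev e) = t e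
  t_rev : ∀ e, t (rev e) = o e
  finite_star : ∀ v, {e | t e = v}.Finite

namespace OrientedGraph

variable {V E : Type*} (X : OrientedGraph V E)

/-- The oriented edges with terminus `v`. -/
def edgesInto (v : V) : Finset E := (X.finite_star v).toFinset

/-- The valence of a vertex (a loop counts twice). -/
def valence (v : V) : ℕ := (X.edgesInto v).card

/-- A `U(1)`-valued weight function, i.e. a `U(1)`-valued function on the oriented edges that
is compatible with reversal of the orientation. -/
structure WeightFunction where
  toFun : E → Circle
  map_rev : ∀ e, toFun (X.rev e) = (toFun e)⁻¹

/-- The weight function `σ` is rational: `σ ^ n = 1` for some positive integer `n`. -/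
def WeightFunction.IsRational {X : OrientedGraph V E} (σ : X.WeightFunction) : Prop :=
  ∃ n : ℕ, 0 < n ∧ ∀ e, σ.toFun e ^ n = 1

/-- The discrete magnetic Laplacian on all complex functions on the vertices,
`(Δ_σ f)(v) = O(v) f(v) - ∑_{t(e) = v} σ(e) f(o(e))`. The sum is over all *oriented* edges with
terminus `v`. With an orientation `E⁺` of the graph fixed, an edge of `E⁺` with origin `v`
contributes through its reversal, namely the term `conj (σ e) * f (t e)`. -/
def dmlLin (σ : X.WeightFunction) : (V → ℂ) →ₗ[ℂ] (V → ℂ) where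
  toFun f v := (X.valence v : ℂ) * f v - ∑ e ∈ X.edgesInto v, (σ.toFun e : ℂ) * f (X.o e)
  map_add' f g := by
    ext v
    simp only [Pi.add_apply, mul_add, Finset.sum_add_distrib]
    ring
  map_smul' c f := by
    ext v
    simp only [Pi.smul_apply, smul_eq_mul, RingHom.id_apply, mul_sub, Finset.mul_sum]
    congr 1
    · ring
    · exact Finset.sum_congr rfl fun e _ => by ring

/-- The valences of the vertices are uniformly bounded. -/
def BoundedValence : Prop := ∃ N : ℕ, ∀ v, X.valence v ≤ N

variable {X}

lemma card_edgesInto_le {N : ℕ} (hN : ∀ v, X.valence v ≤ N) (v : V) :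
    (X.edgesInto v).card ≤ N := hN v

lemma norm_dmlLin_sq_le {N : ℕ} (hN : ∀ v, X.valence v ≤ N) (σ : X.WeightFunction)
    (f : V → ℂ) (v : V) :
    ‖X.dmlLin σ f v‖ ^ 2 ≤
      2 * (N : ℝ) ^ 2 * ‖f v‖ ^ 2 + 2 * N * ∑ e ∈ X.edgesInto v, ‖f (X.o e)‖ ^ 2 := by
  have h1 : ‖X.dmlLin σ f v‖ ≤ N * ‖f v‖ + ∑ e ∈ X.edgesInto v, ‖f (X.o e)‖ := by
    refine (norm_sub_le _ _).trans (add_le_add ?_ ?_)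
    · rw [norm_mul, Complex.norm_natCast]
      gcongr
      exact_mod_cast hN v
    · refine (norm_sum_le _ _).trans (le_of_eq ?_)
      exact Finset.sum_congr rfl fun e _ => by rw [norm_mul, Circle.norm_coe, one_mul]
  have h2 : (∑ e ∈ X.edgesInto v, ‖f (X.o e)‖) ^ 2 ≤
      N * ∑ e ∈ X.edgesInto v, ‖f (X.o e)‖ ^ 2 := by
    refine sq_sum_le_card_mul_sum_sq.trans ?_
    gcongr
    exact_mod_cast hN v
  have h3 : 0 ≤ ∑ e ∈ X.edgesInto v, ‖f (X.o e)‖ := by positivity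
  have h4 : ‖X.dmlLin σ f v‖ ^ 2 ≤
      (N * ‖f v‖ + ∑ e ∈ X.edgesInto v, ‖f (X.o e)‖) ^ 2 := by gcongr
  nlinarith [sq_nonneg (N * ‖f v‖ - ∑ e ∈ X.edgesInto v, ‖f (X.o e)‖)]

lemma card_filter_o_le {N : ℕ} (hN : ∀ v, X.valence v ≤ N) (T : Finset E) (w : V) :
    (T.filter fun e => X.o e = w).card ≤ N := by
  refine le_trans ?_ (hN w)
  refine Finset.card_le_card_of_injOn X.rev ?_ ?_
  · intro e he
    simp only [Finset.coe_filter, Set.mem_ofPred_eq] at he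
    simp [edgesInto, X.t_rev, he.2]
  · intro e _ e' _ h
    rw [← X.rev_rev e, ← X.rev_rev e', h]

lemma sum_norm_dmlLin_sq_le {N : ℕ} (hN : ∀ v, X.valence v ≤ N) (σ : X.WeightFunction)
    (f : ℓ²(V, ℂ)) (S : Finset V) :
    ∑ v ∈ S, ‖X.dmlLin σ f v‖ ^ (2 : ℝ≥0∞).toReal ≤
      (2 * N * ‖f‖) ^ (2 : ℝ≥0∞).toReal := by
  have hp : 0 < (2 : ℝ≥0∞).toReal := by norm_num
  have hf : ∀ S : Finset V, ∑ v ∈ S, ‖f v‖ ^ 2 ≤ ‖f‖ ^ 2 := fun S => by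
    simpa using lp.sum_rpow_le_norm_rpow hp f S
  have key : ∑ v ∈ S, ∑ e ∈ X.edgesInto v, ‖f (X.o e)‖ ^ 2 ≤ N * ‖f‖ ^ 2 := by
    have hdisj : (S : Set V).PairwiseDisjoint X.edgesInto := by
      intro v _ w _ hvw
      refine Finset.disjoint_left.2 fun e he he' => hvw ?_
      simp only [edgesInto, Set.Finite.mem_toFinset, Set.mem_ofPred_eq] at he he'
      rw [← he, ← he']
    rw [← Finset.sum_biUnion hdisj]
    set T := S.biUnion X.edgesInto
    rw [← Finset.sum_fiberwise_of_maps_to (t := T.image X.o) (g := X.o)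
      (fun e he => Finset.mem_image_of_mem _ he)]
    calc ∑ w ∈ T.image X.o, ∑ e ∈ T.filter (fun e => X.o e = w), ‖f (X.o e)‖ ^ 2
        ≤ ∑ w ∈ T.image X.o, N * ‖f w‖ ^ 2 := by
          refine Finset.sum_le_sum fun w _ => ?_
          rw [Finset.sum_congr rfl (g := fun _ => ‖f w‖ ^ 2)
            (fun e he => by rw [(Finset.mem_filter.1 he).2]), Finset.sum_const, nsmul_eq_mul]
          gcongr
          exact_mod_cast card_filter_o_le hN T w
      _ = N * ∑ w ∈ T.image X.o, ‖f w‖ ^ 2 := by rw [Finset.mul_sum]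
      _ ≤ N * ‖f‖ ^ 2 := by gcongr; exact hf _
  calc ∑ v ∈ S, ‖X.dmlLin σ f v‖ ^ (2 : ℝ≥0∞).toReal
      = ∑ v ∈ S, ‖X.dmlLin σ f v‖ ^ 2 := by simp
    _ ≤ ∑ v ∈ S, (2 * (N : ℝ) ^ 2 * ‖f v‖ ^ 2 +
          2 * N * ∑ e ∈ X.edgesInto v, ‖f (X.o e)‖ ^ 2) :=
        Finset.sum_le_sum fun v _ => norm_dmlLin_sq_le hN σ f v
    _ = 2 * (N : ℝ) ^ 2 * ∑ v ∈ S, ‖f v‖ ^ 2 +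
          2 * N * ∑ v ∈ S, ∑ e ∈ X.edgesInto v, ‖f (X.o e)‖ ^ 2 := by
        rw [Finset.sum_add_distrib, Finset.mul_sum, Finset.mul_sum]
    _ ≤ 2 * (N : ℝ) ^ 2 * ‖f‖ ^ 2 + 2 * N * (N * ‖f‖ ^ 2) := by
        gcongr
        exact hf S
    _ = (2 * N * ‖f‖) ^ (2 : ℝ≥0∞).toReal := by
        simp
        ring

variable (X) in
/-- The discrete magnetic Laplacian `Δ_σ` as a bounded operator on `ℓ²(V)`. -/
def dml (hX : X.BoundedValence) (σ : X.WeightFunction) : ℓ²(V, ℂ) →L[ℂ] ℓ²(V, ℂ) :=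
  LinearMap.mkContinuous
    { toFun := fun f => ⟨X.dmlLin σ f,
        memℓp_gen' (sum_norm_dmlLin_sq_le hX.choose_spec σ f)⟩
      map_add' := fun f g => by
        ext v
        exact congrFun (map_add (X.dmlLin σ) (f : V → ℂ) g) v
      map_smul' := fun c f => by
        ext v
        exact congrFun (map_smul (X.dmlLin σ) c (f : V → ℂ)) v }
    (2 * hX.choose)
    (fun f => lp.norm_le_of_forall_sum_le (by norm_num) (by positivity)
      (sum_norm_dmlLin_sq_le hX.choose_spec σ f))

lemma dml_apply (hX : X.BoundedValence) (σ : X.WeightFunction) (f : ℓ²(V, ℂ)) (v : V) :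
    X.dml hX σ f v =
      (X.valence v : ℂ) * f v - ∑ e ∈ X.edgesInto v, (σ.toFun e : ℂ) * f (X.o e) := rfl

/-! ### Group actions -/

variable (Γ : Type*) [Group Γ] [MulAction Γ V] [MulAction Γ E]

variable (X) in
/-- `Γ` acts on the graph `X` by automorphisms, freely on the vertices. -/
structure IsFreeAction : Prop where
  o_smul : ∀ (γ : Γ) (e : E), X.o (γ • e) = γ • X.o e
  t_smul : ∀ (γ : Γ) (e : E), X.t (γ • e) = γ • X.t e
  rev_smul : ∀ (γ : Γ) (e : E), X.rev (γ • e) = γ • X.rev e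
  free : ∀ (γ : Γ) (v : V), γ • v = v → γ = 1

variable (X) in
/-- A finite fundamental domain for the action of `Γ` on `X`: a finite set of vertices that
contains exactly one vertex of every orbit, together with a finite set of edges (with both
orientations) whose translates are all the edges. One may take exactly one edge of every orbit
of edges, or, for instance, all the edges that touch one of the chosen vertices. -/
structure FundamentalDomain where
  verts : Finset V
  edges : Finset E
  existsUnique_vert : ∀ v : V, ∃! w, w ∈ verts ∧ ∃ γ : Γ, γ • w = v
  exists_edge : ∀ e : E, ∃ e' ∈ edges, ∃ γ : Γ, γ • e' = e
  rev_mem : ∀ e ∈ edges, X.rev e ∈ edges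

variable {Γ}

lemma boundedValence (h : X.IsFreeAction Γ) (F : X.FundamentalDomain Γ) :
    X.BoundedValence := by
  refine ⟨F.edges.card, fun v => ?_⟩
  choose r hr g hg using F.exists_edge
  refine Finset.card_le_card_of_injOn r (fun e _ => hr e) ?_
  intro e he e' he' hee
  simp only [edgesInto, Set.Finite.coe_toFinset, Set.mem_ofPred_eq] at he he'
  have h1 : g e • X.t (r e) = v := by rw [← h.t_smul, hg, he]
  have h2 : g e' • X.t (r e) = v := by rw [hee, ← h.t_smul, hg, he']
  have h3 : (g e')⁻¹ * g e = 1 := h.free _ (X.t (r e)) (by rw [mul_smul, h1, ← h2, inv_smul_smul])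
  have h4 : g e = g e' := (inv_mul_eq_one.1 h3).symm
  rw [← hg e, ← hg e', h4, hee]

variable (Γ) in
/-- The weight function `σ` is weakly `Γ`-invariant: it is cohomologous to each of its
translates. -/
def WeightFunction.IsWeaklyInvariant (σ : X.WeightFunction) : Prop :=
  ∀ γ : Γ, ∃ s : V → Circle, ∀ e,
    σ.toFun (γ • e) = σ.toFun e * s (X.t e) * (s (X.o e))⁻¹

/-! ### Finite subgraphs and the restricted operators -/

/-- The subgraph with vertex set `W` whose edges are those elements of `D` (a set of edges stable
under reversal) that have both endpoints in `W`. -/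
def subgraph (X : OrientedGraph V E) (W : Set V) (D : Set E) (hD : ∀ e ∈ D, X.rev e ∈ D) :
    OrientedGraph W {e : E // e ∈ D ∧ X.o e ∈ W ∧ X.t e ∈ W} where
  o e := ⟨X.o e.1, e.2.2.1⟩
  t e := ⟨X.t e.1, e.2.2.2⟩
  rev e := ⟨X.rev e.1, hD _ e.2.1, by rw [X.o_rev]; exact e.2.2.2,
    by rw [X.t_rev]; exact e.2.2.1⟩
  rev_rev e := Subtype.ext (X.rev_rev e.1)
  rev_ne e h := X.rev_ne e.1 (congrArg Subtype.val h)
  o_rev e := Subtype.ext (X.o_rev e.1)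
  t_rev e := Subtype.ext (X.t_rev e.1)
  finite_star v := by
    refine Set.Finite.of_finite_image ((X.finite_star v.1).subset ?_)
      Subtype.val_injective.injOn
    rintro _ ⟨e, he, rfl⟩
    exact congrArg Subtype.val he

/-- The restriction of a weight function to a subgraph. -/
def WeightFunction.restrict (σ : X.WeightFunction) (W : Set V) (D : Set E)
    (hD : ∀ e ∈ D, X.rev e ∈ D) : (X.subgraph W D hD).WeightFunction where
  toFun e := σ.toFun e.1
  map_rev e := σ.map_rev e.1

namespace FundamentalDomain

variable (F : X.FundamentalDomain Γ) (L : Finset Γ)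

/-- The vertices of the union of the translates `γ F`, `γ ∈ L`. -/
def translateVerts : Set V := {v | ∃ γ ∈ L, ∃ w ∈ F.verts, γ • w = v}

/-- The edges of the union of the translates `γ F`, `γ ∈ L`. -/
def translateEdges : Set E := {e | ∃ γ ∈ L, ∃ e' ∈ F.edges, γ • e' = e}

lemma rev_mem_translateEdges (h : X.IsFreeAction Γ) :
    ∀ e ∈ F.translateEdges L, X.rev e ∈ F.translateEdges L := by
  rintro _ ⟨γ, hγ, e, he, rfl⟩
  exact ⟨γ, hγ, X.rev e, F.rev_mem e he, (h.rev_smul γ e).symm⟩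

end FundamentalDomain

/-- The two boundary conditions for the restricted operators. -/
inductive BoundaryCondition
  | dirichlet
  | neumann

/-- The discrete magnetic Laplacian restricted to the functions on the vertices of the largest
subgraph `X_L` of `X` that is contained in the union of the translates `γ F`, `γ ∈ L`.
* Dirichlet boundary condition: `P Δ_σ P`, with `P` the restriction to the vertices of `X_L`
  (extend by zero, apply the operator of `X`, restrict);
* Neumann boundary condition: the discrete magnetic Laplacian of the finite graph `X_L`. -/
def restrictedDml (h : X.IsFreeAction Γ) (F : X.FundamentalDomain Γ) (σ : X.WeightFunction)
    (L : Finset Γ) : BoundaryCondition → Module.End ℂ (F.translateVerts L → ℂ)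
  | .dirichlet =>
      LinearMap.funLeft ℂ ℂ (Subtype.val : F.translateVerts L → V) ∘ₗ X.dmlLin σ ∘ₗ
        Function.ExtendByZero.linearMap ℂ (Subtype.val : F.translateVerts L → V)
  | .neumann =>
      (X.subgraph _ _ (F.rev_mem_translateEdges L h)).dmlLin
        (σ.restrict _ _ (F.rev_mem_translateEdges L h))

end OrientedGraph

/-! ### Amenability and regular exhaustions -/

/-- Amenability of a discrete group (Følner's condition). -/
def IsAmenableGroup (Γ : Type*) [Group Γ] : Prop :=
  ∀ (K : Finset Γ) (ε : ℝ), 0 < ε → ∃ A : Finset Γ, A.Nonempty ∧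
    ∀ k ∈ K, ((A.filter fun a => a * k ∉ A).card : ℝ) ≤ ε * A.card

section

variable {Γ : Type*} [Group Γ]

/-- The word length of `γ` with respect to `S`: the least number of factors from `S ∪ S⁻¹` in a
product equal to `γ` (used for generating sets `S` only). -/
def wordLength (S : Finset Γ) (γ : Γ) : ℕ :=
  sInf {n | ∃ l : List Γ, l.length = n ∧ (∀ x ∈ l, x ∈ S ∨ x⁻¹ ∈ S) ∧ l.prod = γ}

/-- The (left-invariant) word metric. -/
def wordDist (S : Finset Γ) (γ γ' : Γ) : ℕ := wordLength S (γ⁻¹ * γ')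

/-- The `δ`-neighbourhood `∂_δ L` of the boundary of `L` in the word metric. -/
def boundaryNhd (S : Finset Γ) (δ : ℕ) (L : Finset Γ) : Set Γ :=
  {γ | (∃ x ∈ L, wordDist S γ x < δ) ∧ ∃ y ∉ L, wordDist S γ y < δ}

/-- `Λ 0 ⊆ Λ 1 ⊆ ⋯` is a regular exhaustion of `Γ` with respect to the word metric of the finite
generating set `S`. The sets `∂_δ (Λ k)` are finite, as `S` is. -/
structure IsRegularExhaustion (S : Finset Γ) (Λ : ℕ → Finset Γ) : Prop where
  generates : Subgroup.closure (S : Set Γ) = ⊤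
  mono : Monotone Λ
  exhausts : ∀ γ, ∃ m, γ ∈ Λ m
  tendsto : ∀ δ : ℕ, Filter.Tendsto
    (fun k => ((boundaryNhd S δ (Λ k)).ncard : ℝ) / ((Λ k).card : ℝ)) Filter.atTop (nhds 0)

end

/-! ### Spectral density function and Fuglede-Kadison determinant -/

section

variable {H : Type*} [NormedAddCommGroup H] [InnerProductSpace ℂ H] [CompleteSpace H]

/-- The spectral projection `χ_{(-∞, lam]}(A)` of a bounded self-adjoint operator `A`: the
orthogonal projection onto the kernel of the positive part of `A - lam`. -/
def spectralProj (A : H →L[ℂ] H) (lam : ℝ) : H →L[ℂ] H :=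
  (cfc (fun x : ℝ => max (x - lam) 0) A).ker.starProjection

/-- The absolute value `|A| = (A* A)^{1/2}` of a bounded operator. -/
def absOp (A : H →L[ℂ] H) : H →L[ℂ] H := CFC.abs A

lemma spectralProj_ker_mono (A : H →L[ℂ] H) {a b : ℝ}
    (hab : a ≤ b) :
    (cfc (fun x : ℝ => max (x - a) 0) A).ker ≤ (cfc (fun x : ℝ => max (x - b) 0) A).ker := by
  rcases hab.eq_or_lt with rfl | hlt
  · exact le_rfl
  have hne : ∀ x : ℝ, max (x - a) (b - a) ≠ 0 := fun x =>
    ((sub_pos.2 hlt).trans_le (le_max_right _ _)).ne'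
  have hcont : Continuous fun x : ℝ => max (x - b) 0 / max (x - a) (b - a) :=
    Continuous.div (by fun_prop) (by fun_prop) hne
  have hfac : (fun x : ℝ => max (x - b) 0) =
      fun x : ℝ => (max (x - b) 0 / max (x - a) (b - a)) * max (x - a) 0 := by
    ext x
    rcases le_total x b with hx | hx
    · rw [max_eq_right (by linarith : x - b ≤ 0)]
      simp
    · rw [max_eq_left (by linarith : b - a ≤ x - a), max_eq_left (by linarith : (0 : ℝ) ≤ x - a),
        div_mul_cancel₀]
      linarith
  intro f hf
  rw [hfac, cfc_mul _ _ A hcont.continuousOn (by fun_prop)]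
  simp only [LinearMap.mem_ker, ContinuousLinearMap.coe_coe] at hf ⊢
  rw [mul_apply_eq_comp, hf, map_zero]

lemma re_inner_spectralProj_mono (A : H →L[ℂ] H) {a b : ℝ} (hab : a ≤ b) (f : H) :
    (inner ℂ f (spectralProj (absOp A) a f)).re ≤
      (inner ℂ f (spectralProj (absOp A) b f)).re := by
  have hle := spectralProj_ker_mono (absOp A) hab
  have hre : ∀ (U : Submodule ℂ H) [U.HasOrthogonalProjection],
      (inner ℂ f (U.starProjection f)).re = ‖U.starProjection f‖ ^ 2 := fun U _ => by
    have h := Submodule.re_inner_starProjection_eq_normSq (K := U) f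
    rw [← inner_conj_symm, Complex.conj_re]
    exact h
  unfold spectralProj
  rw [hre, hre, ← Submodule.starProjection_comp_starProjection_of_le hle]
  gcongr
  exact Submodule.norm_starProjection_apply_le _ _

end

section

variable {V : Type*}

/-- The von Neumann trace `∑_{v ∈ F} k(v, v)`, where `k` is the matrix of `A` and `F` is the
set of vertices of a fundamental domain. On the algebra of the bounded operators that commute
with the magnetic translations `(T_γ f)(x) = s_γ(γ⁻¹ x) f(γ⁻¹ x)` it does not depend on `F`. -/
def vnTrace (F : Finset V) (A : ℓ²(V, ℂ) →L[ℂ] ℓ²(V, ℂ)) : ℂ :=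
  ∑ v ∈ F, inner ℂ (lp.single 2 v (1 : ℂ)) (A (lp.single 2 v (1 : ℂ)))

/-- The spectral density function `G(lam)` of `A`, the trace of `χ_{[0, lam]}(|A|)` with
`|A| = (A* A)^{1/2}`. For self-adjoint `A`, integrating `log lam` against `dG` over `lam > 0` is
integrating `log |lam|` over `lam ≠ 0` against the density of the spectral family of `A`. -/
def spectralDensity (F : Finset V) (A : ℓ²(V, ℂ) →L[ℂ] ℓ²(V, ℂ)) (lam : ℝ) : ℝ :=
  (vnTrace F (spectralProj (absOp A) lam)).re

lemma spectralDensity_monotone (F : Finset V) (A : ℓ²(V, ℂ) →L[ℂ] ℓ²(V, ℂ)) :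
    Monotone (spectralDensity F A) := by
  intro a b hab
  simp only [spectralDensity, vnTrace, Complex.re_sum]
  exact Finset.sum_le_sum fun v _ => re_inner_spectralProj_mono A hab _

/-- The Stieltjes measure `dG` of the spectral density function of `A`. (`G` is right
continuous, so that the right limits of `G`, from which Mathlib builds the Stieltjes function of
a monotone function, are the values of `G`.) -/
def spectralDensityMeasure (F : Finset V) (A : ℓ²(V, ℂ) →L[ℂ] ℓ²(V, ℂ)) : Measure ℝ :=
  (spectralDensity_monotone F A).stieltjesFunction.measure

/-- The Fuglede-Kadison determinant of `A`: the exponential of the integral of `log lam` against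
`dG(lam)` over `0 < lam ≤ L`, where `L > ‖A‖`, if this integral is not `-∞`, and zero otherwise.
(The logarithm is bounded above on `(0, L]` and `dG` is finite there, so the integral is `-∞`
exactly when the logarithm is not integrable.) -/
def fkDet (F : Finset V) (A : ℓ²(V, ℂ) →L[ℂ] ℓ²(V, ℂ)) : ℝ :=
  if IntegrableOn Real.log (Set.Ioc 0 (‖A‖ + 1)) (spectralDensityMeasure F A) then
    Real.exp (∫ x in Set.Ioc 0 (‖A‖ + 1), Real.log x ∂(spectralDensityMeasure F A))
  else 0

end

end

/-! Off the spectrum `Δ_σ - μ` is invertible, its spectral projections vanish near zero, and the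
determinant is positive (`fkDet_pos_of_isUnit`). A spectral value `μ` is real, by self-adjointness,
and under each remaining alternative algebraic. It thus suffices to treat real algebraic `c`
(`fkDet_dml_sub_pos`).

The arithmetic input concerns the compressions of `Δ_σ - c` to finite vertex sets `W`. Rationality
of `σ` puts all their entries in one number field `K`, with a common denominator `b` and row sums
bounded under every embedding, uniformly in `W`. Up to sign, the product of the nonzero eigenvalues
of `b` times such a matrix is a coefficient of its characteristic polynomial. It is a nonzero
algebraic integer whose conjugates grow at most exponentially in `#W`. Since its field norm is a
nonzero integer, the sum of the logarithms of the nonzero eigenvalues is at least `-C * #W`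
(`exists_eigenvalues_sectionMatrix`).

The bound passes to the limit through moments. On Følner sets the normalized traces of powers
approximate the von Neumann traces (`exists_norm_trace_sectionMatrix_pow_sub_le`); hence, by
polynomial approximation, so do those of continuous functions (`le_of_le_re_vnTrace_of_sum_le`). The
test function `cutoffSum` is dominated by a constant plus a multiple of the negative part of `log
|x|`, which bounds its traces on the sections. It also dominates `∑ₖ (χ(|x| ≤ 2·2⁻ᵏ) - χ(|x| ≤ a))`.
This bounds `∑ₖ (G(2·2⁻ᵏ) - G(a))` independently of `a` and of the number of terms, and as `a → 0`
this makes `log` integrable at zero (`Monotone.integrableOn_log_stieltjes`). -/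

noncomputable section

/-! ### Lower bounds for products of nonzero eigenvalues of algebraic matrices. -/

section Matrices

open Polynomial

variable {ι : Type*}

lemma Polynomial.trailingCoeff_X_sub_C_eq (a : ℂ) :
    (X - C a : ℂ[X]).trailingCoeff = if a = 0 then 1 else -a := by
  split_ifs with h
  · simp [h, Polynomial.trailingCoeff]
  · rw [Polynomial.trailingCoeff_eq_coeff_zero (by simpa using h)]
    simp

lemma Polynomial.trailingCoeff_finset_prod (s : Finset ι) (f : ι → ℂ[X]) :
    (∏ i ∈ s, f i).trailingCoeff = ∏ i ∈ s, (f i).trailingCoeff := by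
  induction s using Finset.induction_on with
  | empty => simp [Polynomial.trailingCoeff]
  | insert a s ha ih => rw [Finset.prod_insert ha, Finset.prod_insert ha, trailingCoeff_mul, ih]

variable [Fintype ι] [DecidableEq ι]

/-- The lowest nonzero coefficient is, up to sign, the product of the nonzero eigenvalues. The
convention `Real.log 0 = 0` removes the zero eigenvalues from the sum. -/
lemma Matrix.IsHermitian.log_norm_trailingCoeff_charpoly {B : Matrix ι ι ℂ}
    (hB : B.IsHermitian) :
    Real.log ‖B.charpoly.trailingCoeff‖ = ∑ i, Real.log |hB.eigenvalues i| := by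
  rw [hB.charpoly_eq, Polynomial.trailingCoeff_finset_prod, norm_prod, Real.log_prod]
  · refine Finset.sum_congr rfl fun i _ => ?_
    rw [Polynomial.trailingCoeff_X_sub_C_eq]
    split_ifs with h
    · have : hB.eigenvalues i = 0 := by simpa using h
      simp [this]
    · simp
  · intro i _
    rw [Polynomial.trailingCoeff_X_sub_C_eq]
    split_ifs with h
    · simp
    · simpa using h

lemma Matrix.IsHermitian.trace_pow {B : Matrix ι ι ℂ} (hB : B.IsHermitian) (j : ℕ) :
    (B ^ j).trace = ∑ i, (hB.eigenvalues i : ℂ) ^ j := by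
  conv_lhs => rw [hB.spectral_theorem]
  rw [← map_pow, Unitary.conjStarAlgAut_apply, Matrix.trace_mul_cycle]
  simp [Matrix.diagonal_pow, Matrix.trace]

/-- The Gershgorin bound for the roots of the characteristic polynomial. -/
lemma Matrix.norm_le_of_isRoot_charpoly {B : Matrix ι ι ℂ} {R : ℝ}
    (hR : ∀ i, ∑ j, ‖B i j‖ ≤ R) {z : ℂ} (hz : B.charpoly.IsRoot z) : ‖z‖ ≤ R := by
  rw [← Matrix.mem_spectrum_iff_isRoot_charpoly, ← Matrix.spectrum_toLin',
    ← Module.End.hasEigenvalue_iff_mem_spectrum] at hz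
  obtain ⟨k, hk⟩ := eigenvalue_mem_ball hz
  rw [mem_closedBall_iff_norm] at hk
  calc ‖z‖ = ‖B k k + (z - B k k)‖ := by ring_nf
    _ ≤ ‖B k k‖ + ∑ j ∈ Finset.univ.erase k, ‖B k j‖ := (norm_add_le _ _).trans (by gcongr)
    _ = ∑ j, ‖B k j‖ := Finset.add_sum_erase _ (fun j => ‖B k j‖) (Finset.mem_univ k)
    _ ≤ R := hR k

/-- Coefficients are elementary symmetric functions of roots of modulus at most `R`; the factor `2 ^
n` absorbs the binomial coefficient. -/
lemma Matrix.norm_coeff_charpoly_le {B : Matrix ι ι ℂ} {R : ℝ} (hR1 : 1 ≤ R)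
    (hR : ∀ i, ∑ j, ‖B i j‖ ≤ R) (k : ℕ) :
    ‖B.charpoly.coeff k‖ ≤ (R * 2) ^ Fintype.card ι := by
  have h := Polynomial.coeff_bdd_of_roots_le (B := R) (d := Fintype.card ι) (RingHom.id ℂ)
    B.charpoly_monic (IsAlgClosed.splits _) B.charpoly_natDegree_eq_dim.le
    (fun z hz => by
      rw [Polynomial.map_id] at hz
      exact Matrix.norm_le_of_isRoot_charpoly hR (Polynomial.isRoot_of_mem_roots hz)) k
  rw [Polynomial.map_id, max_eq_left hR1] at h
  refine h.trans ?_
  rw [mul_pow]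
  gcongr
  exact_mod_cast Nat.choose_le_two_pow _ _

/-- A nonzero algebraic integer, all conjugates of which are bounded, is bounded away from
zero. -/
lemma NumberField.one_le_norm_mul_pow {K : Type*} [Field K] [NumberField K] {c : K}
    (hc : IsIntegral ℤ c) (hc0 : c ≠ 0) {R : ℝ} (hR1 : 1 ≤ R)
    (hR : ∀ φ : K →ₐ[ℚ] ℂ, ‖φ c‖ ≤ R) (φ : K →ₐ[ℚ] ℂ) :
    1 ≤ ‖φ c‖ * R ^ Module.finrank ℚ K := by
  have h1 : IsIntegral ℤ (Algebra.norm ℚ c) := Algebra.isIntegral_norm ℚ hc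
  obtain ⟨n, hn⟩ := IsIntegrallyClosed.isIntegral_iff.1 h1
  -- The norm is a nonzero rational integer, so the product of all conjugates has modulus at least
  -- one.
  have hn0 : n ≠ 0 := by
    rintro rfl
    rw [map_zero] at hn
    exact hc0 (Algebra.norm_eq_zero_iff.1 hn.symm)
  have h2 := Algebra.norm_eq_prod_embeddings ℚ ℂ c
  rw [← hn] at h2
  have h3 : (1 : ℝ) ≤ ‖((n : ℤ) : ℂ)‖ := by
    rw [Complex.norm_intCast]
    exact_mod_cast Int.one_le_abs hn0
  have h4 : ((n : ℤ) : ℂ) = ∏ σ : K →ₐ[ℚ] ℂ, σ c := by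
    rw [← h2]; simp
  rw [h4, norm_prod, ← Finset.mul_prod_erase _ _ (Finset.mem_univ φ)] at h3
  refine h3.trans ?_
  gcongr
  calc ∏ σ ∈ Finset.univ.erase φ, ‖σ c‖ ≤ ∏ σ ∈ Finset.univ.erase φ, R :=
        Finset.prod_le_prod (fun _ _ => norm_nonneg _) fun σ _ => hR σ
    _ = R ^ (Finset.univ.erase φ).card := by rw [Finset.prod_const]
    _ ≤ R ^ Module.finrank ℚ K := by
        refine pow_le_pow_right₀ hR1 ((Finset.card_le_univ _).trans ?_)
        rw [AlgHom.card]

/-- The logarithms of the nonzero eigenvalues of a Hermitian matrix of algebraic integers have a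
lower bound that is linear in the size of the matrix. -/
lemma Matrix.IsHermitian.sum_log_abs_eigenvalues_ge {K : Type*} [Field K] [NumberField K]
    (M : Matrix ι ι K) (hM : ∀ i j, IsIntegral ℤ (M i j)) {R : ℝ} (hR1 : 1 ≤ R)
    (hR : ∀ φ : K →ₐ[ℚ] ℂ, ∀ i, ∑ j, ‖φ (M i j)‖ ≤ R) (φ : K →ₐ[ℚ] ℂ)
    {B : Matrix ι ι ℂ} (hB : B.IsHermitian) (hBM : B = M.map φ) :
    -(Module.finrank ℚ K * Real.log (R * 2)) * Fintype.card ι ≤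
      ∑ i, Real.log |hB.eigenvalues i| := by
  rw [← hB.log_norm_trailingCoeff_charpoly]
  have hmap : ∀ ψ : K →ₐ[ℚ] ℂ, ∀ k, ψ (M.charpoly.coeff k) = (M.map ψ).charpoly.coeff k := by
    intro ψ k
    have h := Matrix.charpoly_map M ψ.toRingHom
    calc ψ (M.charpoly.coeff k) = (M.charpoly.map ψ.toRingHom).coeff k :=
          (Polynomial.coeff_map ψ.toRingHom k).symm
      _ = (M.map ψ).charpoly.coeff k := by rw [← h]; rfl
  -- The index is fixed by the complex matrix; the coefficient itself is taken in `K`, so that its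
  -- other conjugates are coefficients of the conjugate characteristic polynomials.
  set k := B.charpoly.natTrailingDegree
  set c := M.charpoly.coeff k with hc
  have hφc : φ c = B.charpoly.trailingCoeff := by
    rw [hmap, ← hBM]; rfl
  have hc0 : c ≠ 0 := by
    intro h0
    rw [h0, map_zero] at hφc
    exact B.charpoly_monic.ne_zero (Polynomial.trailingCoeff_eq_zero.1 hφc.symm)
  have hint : IsIntegral ℤ c := by
    have h : M = Matrix.map (Matrix.of fun i j => (⟨M i j, hM i j⟩ : integralClosure ℤ K))
        (algebraMap (integralClosure ℤ K) K) := rfl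
    rw [hc, h, Matrix.charpoly_map, Polynomial.coeff_map]
    exact Subtype.property _
  have h := NumberField.one_le_norm_mul_pow hint hc0 (R := (R * 2) ^ Fintype.card ι)
    (one_le_pow₀ (by linarith))
    (fun ψ => by
      rw [hmap]
      exact Matrix.norm_coeff_charpoly_le hR1 (hR ψ) k) φ
  rw [hφc] at h
  have hpos : 0 < ‖B.charpoly.trailingCoeff‖ := by
    rw [← hφc, norm_pos_iff]
    simpa using hc0
  have h' := Real.log_le_log one_pos h
  rw [Real.log_one, Real.log_mul hpos.ne' (by positivity), ← pow_mul, Real.log_pow] at h'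
  push_cast at h'
  linarith

/-- Real numbers that behave as the eigenvalues of a Hermitian matrix with algebraic entries of
which `b` is a common denominator. -/
lemma Matrix.IsHermitian.exists_eigenvalues_of_isIntegral_smul {K : Type*} [Field K]
    [NumberField K] (M : Matrix ι ι K) {b : ℤ} (hb : b ≠ 0)
    (hM : ∀ i j, IsIntegral ℤ (b * M i j)) {R : ℝ} (hR1 : 1 ≤ R)
    (hR : ∀ φ : K →ₐ[ℚ] ℂ, ∀ i, ∑ j, ‖φ (M i j)‖ ≤ R) (φ : K →ₐ[ℚ] ℂ)
    {B : Matrix ι ι ℂ} (hB : B.IsHermitian) (hBM : B = M.map φ) :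
    ∃ l : ι → ℝ, (∀ j, (B ^ j).trace = ∑ i, (l i : ℂ) ^ j) ∧ (∀ i, |l i| ≤ R) ∧
      -(Module.finrank ℚ K * Real.log (|(b : ℝ)| * R * 2) + Real.log |(b : ℝ)|) *
        Fintype.card ι ≤ ∑ i, Real.log |l i| := by
  have hbR : (b : ℝ) ≠ 0 := by exact_mod_cast hb
  have hbC : (b : ℂ) ≠ 0 := by exact_mod_cast hb
  have hb1 : (1 : ℝ) ≤ |(b : ℝ)| := by exact_mod_cast Int.one_le_abs hb
  have hB' : ((b : ℂ) • B).IsHermitian := by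
    rw [Matrix.IsHermitian, Matrix.conjTranspose_smul, hB.eq]
    simp
  have hBM' : (b : ℂ) • B = Matrix.map (Matrix.of fun i j => (b : K) * M i j) φ := by
    ext i j
    simp [hBM]
  have hrow : ∀ φ : K →ₐ[ℚ] ℂ, ∀ i, ∑ j, ‖φ ((b : K) * M i j)‖ ≤ |(b : ℝ)| * R := by
    intro ψ i
    simp only [map_mul, map_intCast, norm_mul, Complex.norm_intCast, ← Finset.mul_sum]
    gcongr
    exact hR ψ i
  have key := Matrix.IsHermitian.sum_log_abs_eigenvalues_ge
    (Matrix.of fun i j => (b : K) * M i j) hM (R := |(b : ℝ)| * R) (by nlinarith) hrow φ hB' hBM'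
  -- Rescaled eigenvalues of `b • B` serve as well as those of `B`, since only power sums and bounds
  -- are needed.
  refine ⟨fun i => hB'.eigenvalues i / b, fun j => ?_, fun i => ?_, ?_⟩
  · have h := hB'.trace_pow j
    rw [_root_.smul_pow, Matrix.trace_smul, smul_eq_mul] at h
    rw [← mul_right_inj' (pow_ne_zero j hbC), h, Finset.mul_sum]
    refine Finset.sum_congr rfl fun i _ => ?_
    push_cast
    rw [div_pow, mul_div_cancel₀ _ (pow_ne_zero j hbC)]
  · have hroot : ((b : ℂ) • B).charpoly.IsRoot (hB'.eigenvalues i : ℂ) := by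
      rw [hB'.charpoly_eq, Polynomial.IsRoot, Polynomial.eval_prod]
      exact Finset.prod_eq_zero (Finset.mem_univ i) (by simp)
    have h := Matrix.norm_le_of_isRoot_charpoly (R := |(b : ℝ)| * R) (fun i => by
      rw [hBM']; exact hrow φ i) hroot
    rw [Complex.norm_real, Real.norm_eq_abs] at h
    rw [abs_div, div_le_iff₀ (by positivity)]
    linarith
  · have hle : ∀ i, Real.log |hB'.eigenvalues i| - Real.log |(b : ℝ)| ≤
        Real.log |hB'.eigenvalues i / b| := by
      intro i
      by_cases h0 : hB'.eigenvalues i = 0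
      -- A zero eigenvalue contributes `log 0 = 0`, which is at least `-log |b|` because `|b| ≥ 1`.
      · simpa [h0] using Real.log_nonneg hb1
      · rw [abs_div, Real.log_div (by simpa using h0) (by positivity)]
    refine le_trans ?_ (Finset.sum_le_sum fun i _ => hle i)
    rw [Finset.sum_sub_distrib, Finset.sum_const, Finset.card_univ, nsmul_eq_mul]
    linarith

end Matrices

/-! ### Matrix of the magnetic Laplacian and its finite sections. -/

namespace OrientedGraph

variable {V E : Type*} (X : OrientedGraph V E)

lemma mem_edgesInto {v : V} {e : E} : e ∈ X.edgesInto v ↔ X.t e = v := by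
  simp [edgesInto]

/-- The matrix of the operator `f ↦ (O(v) - c) f(v) - ∑_{t(e) = v} z(e) f(o(e))` for weights `z`
with values in an arbitrary ring. -/
def weightedKernel {R : Type*} [Ring R] (z : E → R) (c : R) (v w : V) : R :=
  (if v = w then (X.valence v : R) - c else 0) -
    ∑ e ∈ X.edgesInto v, if X.o e = w then z e else 0

variable {X}

/-- Conjugating a section by an embedding of the number field only replaces the weights and the
constant by their conjugates. -/
lemma map_weightedKernel {R S : Type*} [Ring R] [Ring S] (φ : R →+* S) (z : E → R) (c : R)
    (v w : V) :
    φ (X.weightedKernel z c v w) = X.weightedKernel (fun e => φ (z e)) (φ c) v w := by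
  simp only [weightedKernel, map_sub, map_sum, apply_ite φ, map_natCast, map_zero]

lemma isIntegral_mul_weightedKernel {K : Type*} [Field K] {z : E → K} {c : K} {b : ℤ}
    (hz : ∀ e, IsIntegral ℤ (z e)) (hc : IsIntegral ℤ (b * c)) (v w : V) :
    IsIntegral ℤ (b * X.weightedKernel z c v w) := by
  have hb : IsIntegral ℤ (b : K) := isIntegral_algebraMap (R := ℤ) (x := b)
  rw [weightedKernel, mul_sub, mul_ite, mul_sub, mul_zero]
  refine IsIntegral.sub ?_ (hb.mul (IsIntegral.sum _ fun e _ => ?_))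
  · split_ifs
    · exact (hb.mul (isIntegral_natCast _)).sub hc
    · exact isIntegral_zero
  · split_ifs
    · exact hz e
    · exact isIntegral_zero

/-- The bound does not depend on `W`, and it needs only `‖z e‖ ≤ 1`, so it applies to every
conjugate of the weights. -/
lemma sum_norm_weightedKernel_le {N : ℕ} (hN : ∀ v, X.valence v ≤ N) {z : E → ℂ}
    (hz : ∀ e, ‖z e‖ ≤ 1) (c : ℂ) (W : Finset V) (v : V) :
    ∑ w ∈ W, ‖X.weightedKernel z c v w‖ ≤ 2 * N + ‖c‖ := by
  have hNv : (X.valence v : ℝ) ≤ N := by exact_mod_cast hN v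
  have h1 : ∑ w ∈ W, ‖(if v = w then (X.valence v : ℂ) - c else 0)‖ ≤ N + ‖c‖ := by
    simp only [apply_ite norm, norm_zero, Finset.sum_ite_eq]
    split_ifs
    · refine (norm_sub_le _ _).trans ?_
      rw [Complex.norm_natCast]
      gcongr
    · positivity
  have h2 : ∑ w ∈ W, ‖∑ e ∈ X.edgesInto v, if X.o e = w then z e else 0‖ ≤ N := by
    calc _ ≤ ∑ w ∈ W, ∑ e ∈ X.edgesInto v, (if X.o e = w then ‖z e‖ else 0) := by
          refine Finset.sum_le_sum fun w _ => (norm_sum_le _ _).trans (le_of_eq ?_)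
          exact Finset.sum_congr rfl fun e _ => by rw [apply_ite norm, norm_zero]
      _ = ∑ e ∈ X.edgesInto v, (if X.o e ∈ W then ‖z e‖ else 0) := by
          rw [Finset.sum_comm]
          exact Finset.sum_congr rfl fun e _ => by rw [Finset.sum_ite_eq]
      _ ≤ ∑ e ∈ X.edgesInto v, 1 := by
          refine Finset.sum_le_sum fun e _ => ?_
          split_ifs
          · exact hz e
          · exact zero_le_one
      _ = X.valence v := by simp [valence]
      _ ≤ N := hNv
  calc _ ≤ ∑ w ∈ W, (‖(if v = w then (X.valence v : ℂ) - c else 0)‖ +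
        ‖∑ e ∈ X.edgesInto v, if X.o e = w then z e else 0‖) :=
        Finset.sum_le_sum fun w _ => norm_sub_le _ _
    _ ≤ 2 * N + ‖c‖ := by rw [Finset.sum_add_distrib]; linarith

/-- The operator `Δ_σ - c` on all functions on the vertices. -/
def dmlSub (σ : X.WeightFunction) (c : ℂ) : Module.End ℂ (V → ℂ) := X.dmlLin σ - c • 1

lemma dmlSub_apply (σ : X.WeightFunction) (c : ℂ) (f : V → ℂ) (v : V) :
    dmlSub σ c f v =
      (X.valence v : ℂ) * f v - (∑ e ∈ X.edgesInto v, (σ.toFun e : ℂ) * f (X.o e)) - c * f v :=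
  rfl

lemma dmlSub_single (σ : X.WeightFunction) (c : ℂ) (v w : V) :
    dmlSub σ c (Pi.single w 1) v = X.weightedKernel (fun e => (σ.toFun e : ℂ)) c v w := by
  simp only [dmlSub_apply, weightedKernel, Pi.single_apply, mul_ite, mul_one, mul_zero]
  split_ifs <;> ring

/-- Edge reversal exchanges the edges from `w` to `v` with those from `v` to `w` and conjugates the
weights. -/
lemma conj_weightedKernel (σ : X.WeightFunction) (c : ℝ) (v w : V) :
    (starRingEnd ℂ) (X.weightedKernel (fun e => (σ.toFun e : ℂ)) c v w) =
      X.weightedKernel (fun e => (σ.toFun e : ℂ)) c w v := by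
  rw [map_weightedKernel, weightedKernel, weightedKernel, Complex.conj_ofReal]
  congr 1
  · by_cases h : v = w
    · simp [h]
    · simp [h, Ne.symm h]
  · rw [← Finset.sum_filter, ← Finset.sum_filter]
    refine Finset.sum_nbij' X.rev X.rev ?_ ?_ ?_ ?_ ?_
    · intro e he
      simp only [Finset.mem_filter, mem_edgesInto, X.t_rev, X.o_rev] at he ⊢
      exact he.symm
    · intro e he
      simp only [Finset.mem_filter, mem_edgesInto, X.t_rev, X.o_rev] at he ⊢
      exact he.symm
    · intro e _
      exact X.rev_rev e
    · intro e _
      exact X.rev_rev e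
    · intro e _
      rw [σ.map_rev, Circle.coe_inv_eq_conj]

lemma finite_support_dmlSub (σ : X.WeightFunction) (c : ℂ) {f : V → ℂ}
    (hf : f.support.Finite) : (dmlSub σ c f).support.Finite := by
  refine (hf.union (hf.biUnion fun w _ => ((X.edgesInto w).image X.o).finite_toSet)).subset ?_
  intro v hv
  by_contra h
  simp only [Set.mem_union, Set.mem_iUnion, Function.mem_support, Finset.coe_image, Set.mem_image,
    Finset.mem_coe, mem_edgesInto, not_or, not_exists, not_and, not_not] at h
  refine hv ?_
  rw [dmlSub_apply, h.1, Finset.sum_eq_zero]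
  · simp
  · intro e he
    rw [mem_edgesInto] at he
    by_cases h0 : f (X.o e) = 0
    · rw [h0, mul_zero]
    · exact absurd ((X.o_rev e).trans he) (h.2 _ h0 (X.rev e) (X.t_rev e))

lemma finite_support_dmlSub_pow (σ : X.WeightFunction) (c : ℂ) (j : ℕ) (v : V) :
    ((dmlSub σ c ^ j) (Pi.single v 1)).support.Finite := by
  induction j with
  | zero =>
    refine (Set.finite_singleton v).subset fun w hw => ?_
    by_contra h
    exact hw (by simp [show w ≠ v from h])
  | succ j ih =>
    rw [pow_succ', Module.End.mul_apply]
    exact finite_support_dmlSub σ c ih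

lemma eq_sum_smul_single {W : Finset V} {f : V → ℂ} (hf : ∀ v, f v ≠ 0 → v ∈ W) :
    f = ∑ w ∈ W, f w • Pi.single w (1 : ℂ) := by
  ext v
  simp only [Finset.sum_apply, Pi.smul_apply, Pi.single_apply, smul_eq_mul, mul_ite, mul_one,
    mul_zero, Finset.sum_ite_eq]
  split_ifs with h
  · rfl
  · by_contra h'
    exact h (hf v h')

/-- The compression of `Δ_σ - c` to the functions supported on a finite set of vertices. -/
def sectionMatrix (σ : X.WeightFunction) (c : ℂ) (W : Finset V) : Matrix W W ℂ :=
  Matrix.of fun v w => X.weightedKernel (fun e => (σ.toFun e : ℂ)) c v w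

lemma isHermitian_sectionMatrix (σ : X.WeightFunction) (c : ℝ) (W : Finset V) :
    (sectionMatrix σ (c : ℂ) W).IsHermitian := by
  ext v w
  exact conj_weightedKernel σ c w v

/-- Truncation changes nothing while the iterates stay in `W`. The `j`-th iterate itself may leave
`W`, as it is only evaluated at a point of `W`. -/
lemma sectionMatrix_pow_apply (σ : X.WeightFunction) (c : ℂ) (W : Finset V) (w : W) (j : ℕ)
    (h : ∀ i < j, ∀ x, (dmlSub σ c ^ i) (Pi.single w.1 1) x ≠ 0 → x ∈ W) (v : W) :
    (sectionMatrix σ c W ^ j) v w = (dmlSub σ c ^ j) (Pi.single w.1 1) v.1 := by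
  induction j generalizing v with
  | zero =>
    by_cases hvw : v = w
    · simp [hvw]
    · simp [hvw, Subtype.val_injective.ne hvw]
  | succ j ih =>
    rw [pow_succ', pow_succ', Module.End.mul_apply, Matrix.mul_apply]
    conv_rhs => rw [eq_sum_smul_single (h j j.lt_succ_self), map_sum]
    rw [Finset.sum_apply, ← Finset.sum_coe_sort W]
    refine Finset.sum_congr rfl fun u _ => ?_
    rw [ih (fun i hi => h i (hi.trans j.lt_succ_self)), map_smul, Pi.smul_apply, dmlSub_single,
      smul_eq_mul, mul_comm]
    rfl

lemma _root_.Matrix.sum_norm_pow_le {ι : Type*} [Fintype ι] [DecidableEq ι]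
    (M : Matrix ι ι ℂ) {R : ℝ}
    (hR : ∀ i, ∑ j, ‖M i j‖ ≤ R) (k : ℕ) (i : ι) : ∑ j, ‖(M ^ k) i j‖ ≤ R ^ k := by
  induction k generalizing i with
  | zero => simp [Matrix.one_apply, apply_ite norm]
  | succ k ih =>
    have hR0 : 0 ≤ R := (Finset.sum_nonneg fun _ _ => norm_nonneg _).trans (hR i)
    simp only [pow_succ' M, Matrix.mul_apply]
    calc _ ≤ ∑ j, ∑ u, ‖M i u‖ * ‖(M ^ k) u j‖ :=
          Finset.sum_le_sum fun j _ => (norm_sum_le _ _).trans (by simp)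
      _ = ∑ u, ‖M i u‖ * ∑ j, ‖(M ^ k) u j‖ := by
          rw [Finset.sum_comm]; simp [Finset.mul_sum]
      _ ≤ ∑ u, ‖M i u‖ * R ^ k := by gcongr with u; exact ih u
      _ ≤ R ^ (k + 1) := by rw [← Finset.sum_mul, pow_succ']; gcongr; exact hR i

lemma norm_sectionMatrix_pow_le {N : ℕ} (hN : ∀ v, X.valence v ≤ N) (σ : X.WeightFunction)
    (c : ℂ) (W : Finset V) (j : ℕ) (v w : W) :
    ‖(sectionMatrix σ c W ^ j) v w‖ ≤ (2 * N + ‖c‖) ^ j := by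
  refine (Finset.single_le_sum (f := fun w => ‖(sectionMatrix σ c W ^ j) v w‖)
    (fun _ _ => norm_nonneg _) (Finset.mem_univ w)).trans
    (Matrix.sum_norm_pow_le _ (fun i => ?_) j v)
  refine le_trans (le_of_eq ?_)
    (sum_norm_weightedKernel_le hN (z := fun e => (σ.toFun e : ℂ)) (fun e => (Circle.norm_coe _).le) c W i)
  exact Finset.sum_coe_sort W fun w =>
    ‖X.weightedKernel (fun e => (σ.toFun e : ℂ)) c i w‖

/-! ### Translations and approximation of traces along Følner sets. -/

section Action

variable {Γ : Type*} [Group Γ] [MulAction Γ V] [MulAction Γ E]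

lemma sum_edgesInto_smul (hX : X.IsFreeAction Γ) (γ : Γ) (v : V) (f : E → ℂ) :
    ∑ e ∈ X.edgesInto (γ • v), f e = ∑ e ∈ X.edgesInto v, f (γ • e) := by
  symm
  refine Finset.sum_nbij' (fun e => γ • e) (fun e => γ⁻¹ • e) ?_ ?_ ?_ ?_ ?_
  · intro e he
    simp only [mem_edgesInto] at he ⊢
    rw [hX.t_smul, he]
  · intro e he
    simp only [mem_edgesInto] at he ⊢
    rw [hX.t_smul, he, inv_smul_smul]
  · intro e _; simp
  · intro e _; simp
  · intro e _; rfl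

lemma valence_smul (hX : X.IsFreeAction Γ) (γ : Γ) (v : V) :
    X.valence (γ • v) = X.valence v := by
  have h := sum_edgesInto_smul hX γ v fun _ => 1
  simp only [Finset.sum_const, nsmul_eq_mul, mul_one] at h
  exact_mod_cast h

/-- The magnetic translations commute with `Δ_σ - c`. -/
lemma dmlSub_translate (hX : X.IsFreeAction Γ) (σ : X.WeightFunction) (c : ℂ) {γ : Γ}
    {s : V → Circle}
    (hs : ∀ e, σ.toFun (γ • e) = σ.toFun e * s (X.t e) * (s (X.o e))⁻¹)
    {f g : V → ℂ} (hfg : ∀ x, g (γ • x) = s x * f x) (x : V) :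
    dmlSub σ c g (γ • x) = s x * dmlSub σ c f x := by
  have h : ∑ e ∈ X.edgesInto x, (σ.toFun (γ • e) : ℂ) * g (X.o (γ • e)) =
      s x * ∑ e ∈ X.edgesInto x, (σ.toFun e : ℂ) * f (X.o e) := by
    rw [Finset.mul_sum]
    refine Finset.sum_congr rfl fun e he => ?_
    rw [mem_edgesInto] at he
    have h0 : (s (X.o e) : ℂ) ≠ 0 := Circle.coe_ne_zero _
    rw [hX.o_smul, hfg, hs, he]
    push_cast
    field_simp
  rw [dmlSub_apply, dmlSub_apply, hfg, valence_smul hX, sum_edgesInto_smul hX, h]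
  ring

/-- Up to the phase `s v`, the point mass at `γ • v` is the magnetic translate of that at `v`. The
two phases cancel when `x = v`, so diagonal entries of powers are `Γ`-invariant. -/
lemma dmlSub_pow_single_smul (hX : X.IsFreeAction Γ) (σ : X.WeightFunction) (c : ℂ) {γ : Γ}
    {s : V → Circle}
    (hs : ∀ e, σ.toFun (γ • e) = σ.toFun e * s (X.t e) * (s (X.o e))⁻¹) (v : V) (j : ℕ) (x : V) :
    (dmlSub σ c ^ j) (Pi.single (γ • v) 1) (γ • x) =
      s x * (s v : ℂ)⁻¹ * (dmlSub σ c ^ j) (Pi.single v 1) x := by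
  have h0 : (s v : ℂ) ≠ 0 := Circle.coe_ne_zero _
  have h : (dmlSub σ c ^ j) ((s v : ℂ) • Pi.single (γ • v) 1) (γ • x) =
      s x * (dmlSub σ c ^ j) (Pi.single v 1) x := by
    induction j generalizing x with
    | zero =>
      by_cases hx : x = v
      · simp [hx]
      · simp [hx]
    | succ j ih =>
      rw [pow_succ', Module.End.mul_apply, Module.End.mul_apply]
      exact dmlSub_translate hX σ c hs ih x
  rw [map_smul, Pi.smul_apply, smul_eq_mul] at h
  field_simp
  linear_combination h

variable (F : X.FundamentalDomain Γ)

/-- The vertices of the union of the translates `γ F`, `γ ∈ L`, as a finite set. -/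
def FundamentalDomain.translates (L : Finset Γ) : Finset V :=
  (L ×ˢ F.verts).image fun p => p.1 • p.2

variable {F}

lemma FundamentalDomain.smul_mem_translates {L : Finset Γ} {γ : Γ} (hγ : γ ∈ L) {v : V}
    (hv : v ∈ F.verts) : γ • v ∈ F.translates L :=
  Finset.mem_image.2 ⟨(γ, v), Finset.mem_product.2 ⟨hγ, hv⟩, rfl⟩

lemma FundamentalDomain.smul_inj (hX : X.IsFreeAction Γ) {γ γ' : Γ} {v v' : V}
    (hv : v ∈ F.verts) (hv' : v' ∈ F.verts) (h : γ • v = γ' • v') : γ = γ' ∧ v = v' := by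
  have hvv : v = v' :=
    (F.existsUnique_vert (γ • v)).unique ⟨hv, γ, rfl⟩ ⟨hv', γ', h.symm⟩
  subst hvv
  refine ⟨?_, rfl⟩
  have h3 : γ'⁻¹ * γ = 1 := hX.free _ v (by rw [mul_smul, h, inv_smul_smul])
  exact (inv_mul_eq_one.1 h3).symm

lemma FundamentalDomain.injOn_smul (hX : X.IsFreeAction Γ) (L : Finset Γ) :
    Set.InjOn (fun p : Γ × V => p.1 • p.2) (L ×ˢ F.verts : Finset (Γ × V)) := by
  rintro ⟨γ, v⟩ h ⟨γ', v'⟩ h' hh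
  rw [Finset.mem_coe, Finset.mem_product] at h h'
  obtain ⟨h1, h2⟩ := FundamentalDomain.smul_inj hX h.2 h'.2 hh
  rw [Prod.mk.injEq]
  exact ⟨h1, h2⟩

lemma FundamentalDomain.card_translates (hX : X.IsFreeAction Γ) (L : Finset Γ) :
    (F.translates L).card = L.card * F.verts.card := by
  rw [FundamentalDomain.translates, Finset.card_image_of_injOn (injOn_smul hX L),
    Finset.card_product]

lemma FundamentalDomain.sum_translates (hX : X.IsFreeAction Γ) (L : Finset Γ) (f : V → ℂ) :
    ∑ v ∈ F.translates L, f v = ∑ γ ∈ L, ∑ v ∈ F.verts, f (γ • v) := by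
  rw [FundamentalDomain.translates, Finset.sum_image (injOn_smul hX L), Finset.sum_product]

/-- The normalized traces of the powers of the sections of `Δ_σ - c` to the elements of a Følner
sequence approximate the von Neumann traces of the powers of `Δ_σ - c`. -/
lemma exists_norm_trace_sectionMatrix_pow_sub_le (hΓ : IsAmenableGroup Γ)
    (hX : X.IsFreeAction Γ) (σ : X.WeightFunction) (hσ : σ.IsWeaklyInvariant Γ) (c : ℂ)
    (F : X.FundamentalDomain Γ) (J : ℕ) {ε : ℝ} (hε : 0 < ε) :
    ∃ L : Finset Γ, L.Nonempty ∧ ∀ j < J,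
      ‖(sectionMatrix σ c (F.translates L) ^ j).trace -
        L.card * ∑ v ∈ F.verts, (dmlSub σ c ^ j) (Pi.single v 1) v‖ ≤ ε * L.card := by
  obtain ⟨N, hN⟩ := boundedValence hX F
  have hr : ∀ x : V, ∃ k : Γ, ∃ w ∈ F.verts, k • w = x := fun x => by
    obtain ⟨w, ⟨hw, k, hk⟩, -⟩ := F.existsUnique_vert x
    exact ⟨k, w, hw, hk⟩
  choose r hr using hr
  have hfin : (⋃ v ∈ F.verts, ⋃ i ∈ Finset.range J,
      ((dmlSub σ c ^ i) (Pi.single v 1)).support).Finite :=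
    F.verts.finite_toSet.biUnion fun v _ => (Finset.range J).finite_toSet.biUnion fun i _ =>
      finite_support_dmlSub_pow σ c i v
  -- The finitely many group elements by which the first `J` iterates of point masses in the
  -- fundamental domain can spread.
  set K : Finset Γ := hfin.toFinset.image r with hK
  have hKmem : ∀ v ∈ F.verts, ∀ i < J, ∀ x, (dmlSub σ c ^ i) (Pi.single v 1) x ≠ 0 → r x ∈ K := by
    intro v hv i hi x hx
    refine Finset.mem_image_of_mem _ ?_
    simp only [Set.Finite.mem_toFinset, Set.mem_iUnion]
    exact ⟨v, hv, i, Finset.mem_range.2 hi, hx⟩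
  set C : ℕ → ℝ := fun j => ∑ v ∈ F.verts,
    ((2 * N + ‖c‖) ^ j + ‖(dmlSub σ c ^ j) (Pi.single v 1) v‖) with hC
  have hC0 : ∀ j, 0 ≤ C j := fun j => Finset.sum_nonneg fun _ _ => by positivity
  set C' : ℝ := ∑ j ∈ Finset.range J, C j with hC'
  have hC'0 : 0 ≤ C' := Finset.sum_nonneg fun j _ => hC0 j
  -- Each bad `γ` costs at most `C'`, and there are at most `K.card` times the Følner error of them;
  -- the `+ 1` keeps the denominator positive.
  obtain ⟨L, hL, hLK⟩ := hΓ K (ε / (K.card * C' + 1)) (by positivity)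
  refine ⟨L, hL, fun j hj => ?_⟩
  set bad : Finset Γ := K.biUnion fun k => L.filter fun a => a * k ∉ L with hbad
  have hbad_card : (bad.card : ℝ) ≤ K.card * (ε / (K.card * C' + 1) * L.card) := by
    have h1 : bad.card ≤ ∑ k ∈ K, (L.filter fun a => a * k ∉ L).card := Finset.card_biUnion_le
    calc (bad.card : ℝ) ≤ ∑ k ∈ K, ((L.filter fun a => a * k ∉ L).card : ℝ) := by
          exact_mod_cast h1
      _ ≤ ∑ k ∈ K, (ε / (K.card * C' + 1) * L.card) := Finset.sum_le_sum hLK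
      _ = _ := by rw [Finset.sum_const, nsmul_eq_mul]
  set d : V → ℂ := fun w => if h : w ∈ F.translates L then
    (sectionMatrix σ c (F.translates L) ^ j) ⟨w, h⟩ ⟨w, h⟩ else 0 with hd
  have htr : (sectionMatrix σ c (F.translates L) ^ j).trace =
      ∑ γ ∈ L, ∑ v ∈ F.verts, d (γ • v) := by
    rw [← FundamentalDomain.sum_translates hX, ← Finset.sum_coe_sort]
    refine Finset.sum_congr rfl fun w _ => ?_
    simp only [hd, w.2, dif_pos, Matrix.diag_apply]
  have hdiff : (sectionMatrix σ c (F.translates L) ^ j).trace -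
        L.card * ∑ v ∈ F.verts, (dmlSub σ c ^ j) (Pi.single v 1) v =
      ∑ γ ∈ L, ∑ v ∈ F.verts, (d (γ • v) - (dmlSub σ c ^ j) (Pi.single v 1) v) := by
    rw [htr]
    simp only [Finset.sum_sub_distrib, Finset.sum_const, nsmul_eq_mul]
  -- For such `γ` the relevant iterates starting at `γ • v` never leave the section, so the
  -- truncated and the full diagonal entries agree.
  have hgood : ∀ γ ∈ L, γ ∉ bad → ∀ v ∈ F.verts,
      d (γ • v) - (dmlSub σ c ^ j) (Pi.single v 1) v = 0 := by
    intro γ hγ hγb v hv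
    obtain ⟨s, hs⟩ := hσ γ
    have hmem := FundamentalDomain.smul_mem_translates hγ hv
    simp only [hd, hmem, dif_pos]
    rw [sectionMatrix_pow_apply σ c _ ⟨γ • v, hmem⟩ j ?_ ⟨γ • v, hmem⟩,
      dmlSub_pow_single_smul hX σ c hs, mul_inv_cancel₀ (Circle.coe_ne_zero _), one_mul, sub_self]
    intro i hi x hx
    obtain ⟨y, rfl⟩ : ∃ y, γ • y = x := ⟨γ⁻¹ • x, smul_inv_smul γ x⟩
    rw [dmlSub_pow_single_smul hX σ c hs] at hx
    have hy := hKmem v hv i (hi.trans hj) y (right_ne_zero_of_mul hx)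
    obtain ⟨w, hw, hwy⟩ := hr y
    have hγy : γ * r y ∈ L := by
      by_contra hcon
      exact hγb (Finset.mem_biUnion.2 ⟨r y, hy, Finset.mem_filter.2 ⟨hγ, hcon⟩⟩)
    rw [← hwy, smul_smul]
    exact FundamentalDomain.smul_mem_translates hγy hw
  have hd_le : ∀ w, ‖d w‖ ≤ (2 * N + ‖c‖) ^ j := by
    intro w
    by_cases h : w ∈ F.translates L
    · simp only [hd, h, dif_pos]
      exact norm_sectionMatrix_pow_le hN σ c _ j _ _
    · simp only [hd, h, dif_neg, not_false_eq_true, norm_zero]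
      positivity
  have hterm : ∀ γ ∈ L, ‖∑ v ∈ F.verts, (d (γ • v) - (dmlSub σ c ^ j) (Pi.single v 1) v)‖ ≤
      if γ ∈ bad then C j else 0 := by
    intro γ hγ
    split_ifs with hb
    · refine (norm_sum_le _ _).trans (Finset.sum_le_sum fun v _ => ?_)
      exact (norm_sub_le _ _).trans (by gcongr; exact hd_le _)
    · rw [Finset.sum_eq_zero (hgood γ hγ hb), norm_zero]
  have hCj : C j ≤ C' :=
    Finset.single_le_sum (f := C) (fun j _ => hC0 j) (Finset.mem_range.2 hj)
  calc _ ≤ ∑ γ ∈ L, (if γ ∈ bad then C j else 0) := by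
        rw [hdiff]; exact (norm_sum_le _ _).trans (Finset.sum_le_sum hterm)
    _ ≤ bad.card * C' := by
        rw [← Finset.sum_filter, Finset.sum_const, nsmul_eq_mul]
        refine mul_le_mul ?_ hCj (hC0 j) (by positivity)
        exact_mod_cast Finset.card_le_card fun γ hγ => (Finset.mem_filter.1 hγ).2
    _ ≤ K.card * (ε / (K.card * C' + 1) * L.card) * C' := by gcongr
    _ = (K.card * C') / (K.card * C' + 1) * (ε * L.card) := by ring
    _ ≤ 1 * (ε * L.card) := by
        gcongr
        rw [div_le_one (by positivity)]
        linarith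
    _ = ε * L.card := one_mul _

end Action

end OrientedGraph

/-! ### Integrability of the logarithm from dyadic sums. -/

section LogIntegrability

open Filter Topology

/-- The number of `k ≥ 0` with `x ≤ 2⁻ᵏ` is `⌊-log x / log 2⌋ + 1`, which exceeds `-log x / log 2`.
-/
lemma enorm_log_le_tsum_indicator {x : ℝ} (hx : x ∈ Set.Ioc (0 : ℝ) 1) :
    ‖Real.log x‖ₑ ≤ ∑' k : ℕ,
      (Set.Ioc (0 : ℝ) ((1 / 2) ^ k)).indicator (fun _ => ENNReal.ofReal (Real.log 2)) x := by
  have hl2 : 0 < Real.log 2 := Real.log_pos one_lt_two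
  have hlx : 0 ≤ -Real.log x := neg_nonneg.2 (Real.log_nonpos hx.1.le hx.2)
  set n := ⌊-Real.log x / Real.log 2⌋₊
  refine le_trans ?_ (ENNReal.sum_le_tsum (Finset.range (n + 1)))
  have hmem : ∀ k ∈ Finset.range (n + 1), x ∈ Set.Ioc (0 : ℝ) ((1 / 2) ^ k) := by
    intro k hk
    refine ⟨hx.1, ?_⟩
    have hk' : (k : ℝ) ≤ -Real.log x / Real.log 2 :=
      (Nat.cast_le.2 (Nat.lt_succ_iff.1 (Finset.mem_range.1 hk))).trans
        (Nat.floor_le (by positivity))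
    rw [le_div_iff₀ hl2] at hk'
    rw [← Real.log_le_log_iff hx.1 (by positivity), Real.log_pow, one_div, Real.log_inv]
    linarith
  rw [Finset.sum_congr rfl fun k hk => Set.indicator_of_mem (hmem k hk) _, Finset.sum_const,
    Finset.card_range, Real.enorm_eq_ofReal_abs, abs_of_nonpos (neg_nonneg.1 hlx), nsmul_eq_mul,
    ← ENNReal.ofReal_natCast, ← ENNReal.ofReal_mul (by positivity)]
  refine ENNReal.ofReal_le_ofReal ?_
  have := Nat.lt_floor_add_one (-Real.log x / Real.log 2)
  rw [div_lt_iff₀ hl2] at this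
  push_cast
  exact this.le

/-- A criterion for the logarithm to be integrable at zero with respect to a Stieltjes measure. -/
lemma Monotone.integrableOn_log_stieltjes {G : ℝ → ℝ} (hG : Monotone G) {C : ℝ}
    (h : ∀ K : ℕ, ∀ a > 0, ∑ k ∈ Finset.range K, (G (2 * (1 / 2) ^ k) - G a) ≤ C) (L : ℝ) :
    IntegrableOn Real.log (Set.Ioc 0 L) hG.stieltjesFunction.measure := by
  have h1 : IntegrableOn Real.log (Set.Icc 1 L) hG.stieltjesFunction.measure := by
    refine ContinuousOn.integrableOn_compact isCompact_Icc (Real.continuousOn_log.mono ?_)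
    intro x hx
    have : (1 : ℝ) ≤ x := hx.1
    simp only [Set.mem_compl_iff, Set.mem_singleton_iff]
    linarith
  have h2 : IntegrableOn Real.log (Set.Ioc 0 1) hG.stieltjesFunction.measure := by
    refine ⟨Real.measurable_log.aestronglyMeasurable, ?_⟩
    set m := hG.stieltjesFunction.measure
    have hsum : ∀ K : ℕ, ∑ k ∈ Finset.range K,
        (hG.stieltjesFunction ((1 / 2) ^ k) - hG.stieltjesFunction 0) ≤ C := by
      intro K
      -- Letting `a` decrease to zero replaces `G a` by the right limit at zero, so that a jump of
      -- `G` at zero is not counted.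
      have hlim : Tendsto (fun a => ∑ k ∈ Finset.range K, (G (2 * (1 / 2) ^ k) - G a)) (𝓝[>] 0)
          (𝓝 (∑ k ∈ Finset.range K, (G (2 * (1 / 2) ^ k) - Function.rightLim G 0))) :=
        tendsto_finsetSum _ fun k _ => tendsto_const_nhds.sub (hG.tendsto_rightLim 0)
      have hle := _root_.le_of_tendsto hlim (eventually_nhdsWithin_of_forall fun a ha => h K a ha)
      refine le_trans (Finset.sum_le_sum fun k _ => ?_) hle
      rw [hG.stieltjesFunction_eq, hG.stieltjesFunction_eq]
      gcongr
      -- The factor `2` leaves room here: a right limit at `2⁻ᵏ` is bounded by the value at any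
      -- strictly larger point.
      refine hG.rightLim_le ?_
      have : (0 : ℝ) < (1 / 2) ^ k := by positivity
      linarith
    have hmeas : ∑' k : ℕ, m (Set.Ioc (0 : ℝ) ((1 / 2) ^ k)) ≤ ENNReal.ofReal C := by
      rw [ENNReal.tsum_eq_iSup_nat]
      refine iSup_le fun K => ?_
      simp only [m, StieltjesFunction.measure_Ioc]
      rw [← ENNReal.ofReal_sum_of_nonneg]
      · exact ENNReal.ofReal_le_ofReal (hsum K)
      · intro k _
        exact sub_nonneg.2 (hG.stieltjesFunction.mono (by positivity))
    calc ∫⁻ x in Set.Ioc 0 1, ‖Real.log x‖ₑ ∂m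
        ≤ ∫⁻ x in Set.Ioc 0 1, ∑' k : ℕ, (Set.Ioc (0 : ℝ) ((1 / 2) ^ k)).indicator
            (fun _ => ENNReal.ofReal (Real.log 2)) x ∂m :=
          setLIntegral_mono' measurableSet_Ioc fun x hx => enorm_log_le_tsum_indicator hx
      _ ≤ ∫⁻ x, ∑' k : ℕ, (Set.Ioc (0 : ℝ) ((1 / 2) ^ k)).indicator
            (fun _ => ENNReal.ofReal (Real.log 2)) x ∂m := setLIntegral_le_lintegral _ _
      _ = ∑' k : ℕ, ENNReal.ofReal (Real.log 2) * m (Set.Ioc (0 : ℝ) ((1 / 2) ^ k)) := by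
          rw [lintegral_tsum fun k => (measurable_const.indicator measurableSet_Ioc).aemeasurable]
          exact tsum_congr fun k => lintegral_indicator_const measurableSet_Ioc _
      _ = ENNReal.ofReal (Real.log 2) * ∑' k : ℕ, m (Set.Ioc (0 : ℝ) ((1 / 2) ^ k)) :=
          ENNReal.tsum_mul_left
      _ ≤ ENNReal.ofReal (Real.log 2) * ENNReal.ofReal C := by gcongr
      _ < ∞ := ENNReal.mul_lt_top ENNReal.ofReal_lt_top ENNReal.ofReal_lt_top
  refine (h2.union h1).mono_set fun x hx => ?_
  rcases le_total x 1 with hx1 | hx1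
  · exact Or.inl ⟨hx.1, hx1⟩
  · exact Or.inr ⟨hx1, hx.2⟩

end LogIntegrability

/-! ### Comparison of spectral projections with continuous functional calculus. -/

section SpectralProjections

variable {H : Type*} [NormedAddCommGroup H] [InnerProductSpace ℂ H]

lemma re_inner_starProjection_eq (U : Submodule ℂ H) [U.HasOrthogonalProjection] (x : H) :
    (inner ℂ x (U.starProjection x)).re = ‖U.starProjection x‖ ^ 2 := by
  have h := Submodule.re_inner_starProjection_eq_normSq (K := U) x
  rw [← inner_conj_symm, Complex.conj_re]
  exact h

lemma re_inner_self_eq (x : H) : (inner ℂ x x).re = ‖x‖ ^ 2 := inner_self_eq_norm_sq (𝕜 := ℂ) x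

variable [CompleteSpace H]

lemma spectralProj_absOp {A : H →L[ℂ] H} (hA : IsSelfAdjoint A) (b : ℝ) :
    spectralProj (absOp A) b =
      (cfc (fun x : ℝ => max (|x| - b) 0) A).ker.starProjection := by
  have h : cfc (fun x : ℝ => max (x - b) 0) (absOp A) =
      cfc (fun x : ℝ => max (|x| - b) 0) A := by
    rw [absOp, CFC.abs_eq_cfc_norm A hA]
    exact (cfc_comp' (fun x : ℝ => max (x - b) 0) (fun x : ℝ => ‖x‖) A (by fun_prop)
      (by fun_prop)).symm
  simp only [spectralProj, h]

lemma re_inner_cfc_mono {A : H →L[ℂ] H} {f g : ℝ → ℝ}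
    (hf : Continuous f) (hg : Continuous g) (hfg : ∀ x ∈ spectrum ℝ A, f x ≤ g x) (x : H) :
    (inner ℂ x (cfc f A x)).re ≤ (inner ℂ x (cfc g A x)).re := by
  have h := (ContinuousLinearMap.le_def _ _).1 (cfc_mono hfg hf.continuousOn hg.continuousOn)
  have h' := h.re_inner_nonneg_right x
  rw [sub_apply, inner_sub_right, map_sub, sub_nonneg] at h'
  exact h'

lemma inner_cfc_comm (A : H →L[ℂ] H) (f : ℝ → ℝ) (x y : H) :
    inner ℂ (cfc f A x) y = inner ℂ x (cfc f A y) := by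
  have h : IsSelfAdjoint (cfc f A) := cfc_predicate f A
  rw [← ContinuousLinearMap.adjoint_inner_right, h.adjoint_eq]

/-- A spectral projection is bounded above by a continuous function of the operator. -/
lemma re_inner_spectralProj_le {A : H →L[ℂ] H} (hA : IsSelfAdjoint A) {b : ℝ} (hb : 0 < b)
    (x : H) :
    (inner ℂ x (spectralProj (absOp A) b x)).re ≤
      (inner ℂ x (cfc (fun x : ℝ => 1 - max (|x| - b) 0 / max b (|x| - b)) A x)).re := by
  rw [spectralProj_absOp hA]
  set T := cfc (fun x : ℝ => max (|x| - b) 0) A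
  set p : ℝ → ℝ := fun x => 1 - max (|x| - b) 0 / max b (|x| - b)
  have hne : ∀ x : ℝ, max b (|x| - b) ≠ 0 := fun x => (hb.trans_le (le_max_left _ _)).ne'
  have hinv : Continuous fun x : ℝ => (max b (|x| - b))⁻¹ :=
    Continuous.inv₀ (by fun_prop) hne
  have hp : Continuous p :=
    continuous_const.sub (Continuous.div (by fun_prop) (by fun_prop) hne)
  set y := T.ker.starProjection x with hy
  have hyT : T y = 0 := Submodule.starProjection_apply_mem T.ker x
  have hBy : cfc p A y = y := by
    -- `1 - p` is a multiple of `(|x| - b)₊`, hence `p(A)` is the identity on the kernel of `T`.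
    have h : cfc p A = 1 - cfc (fun x : ℝ => (max b (|x| - b))⁻¹) A * T := by
      rw [← cfc_mul _ _ A hinv.continuousOn (by fun_prop),
        ← cfc_one ℝ A, ← cfc_sub _ _ A (by fun_prop) (by fun_prop)]
      refine cfc_congr fun x _ => ?_
      simp only [p, Pi.one_apply]
      ring
    rw [h, sub_apply, mul_apply_eq_comp, hyT, map_zero, sub_zero,
      one_apply_eq_self]
  have horth : inner ℂ (x - y) y = 0 := by
    exact Submodule.inner_left_of_mem_orthogonal (Submodule.starProjection_apply_mem T.ker x)
      (Submodule.sub_starProjection_mem_orthogonal x)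
  have hpos : 0 ≤ (inner ℂ (x - y) (cfc p A (x - y))).re := by
    have h := re_inner_cfc_mono (A := A) (f := fun _ => 0) continuous_const hp (fun x _ => by
      simp only [p]
      rw [sub_nonneg, div_le_one (hb.trans_le (le_max_left _ _))]
      exact max_le (le_max_right _ _) (hb.le.trans (le_max_left _ _))) (x - y)
    simpa using h
  rw [re_inner_starProjection_eq, ← hy]
  -- The cross terms vanish because `p(A)` is self-adjoint and fixes `y`, which is orthogonal to `x
  -- - y`.
  have hx : inner ℂ x (cfc p A x) = inner ℂ y y + inner ℂ (x - y) (cfc p A (x - y)) := by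
    have h1 : inner ℂ y (cfc p A (x - y)) = 0 := by
      rw [← inner_cfc_comm, hBy, ← inner_conj_symm, horth, map_zero]
    calc inner ℂ x (cfc p A x) = inner ℂ (y + (x - y)) (cfc p A (y + (x - y))) := by
          rw [add_sub_cancel]
      _ = _ := by
          rw [map_add, inner_add_left, inner_add_right, inner_add_right, hBy, h1, horth]
          ring
  rw [hx, Complex.add_re, re_inner_self_eq]
  linarith

/-- A spectral projection is bounded below by a continuous function of the operator. -/
lemma le_re_inner_spectralProj {A : H →L[ℂ] H} (hA : IsSelfAdjoint A) {a : ℝ} (ha : 0 < a)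
    (x : H) :
    (inner ℂ x (cfc (fun x : ℝ => max 0 (1 - |x| / a)) A x)).re ≤
      (inner ℂ x (spectralProj (absOp A) a x)).re := by
  rw [spectralProj_absOp hA]
  set T := cfc (fun x : ℝ => max (|x| - a) 0) A
  set q : ℝ → ℝ := fun x => max 0 (1 - |x| / a)
  have hq : Continuous q := by fun_prop
  set y := T.ker.starProjection x with hy
  -- `q` and `(|x| - a)₊` have product zero, so `q(A)` maps into the kernel of `T`; by
  -- self-adjointness it annihilates the orthogonal complement.
  have hTB : ∀ z, T (cfc q A z) = 0 := by
    intro z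
    rw [← mul_apply_eq_comp, ← cfc_mul _ _ A (by fun_prop) hq.continuousOn]
    have : (fun x : ℝ => max (|x| - a) 0 * q x) = fun _ => 0 := by
      ext x
      simp only [q]
      rcases le_total |x| a with h | h
      · rw [max_eq_right (by linarith), zero_mul]
      · rw [max_eq_left (a := (0 : ℝ)), mul_zero]
        rw [sub_nonpos, le_div_iff₀ ha]
        linarith
    rw [this]
    simp
  have hBz : cfc q A (x - y) = 0 := by
    rw [← inner_self_eq_zero (𝕜 := ℂ), inner_cfc_comm]
    exact Submodule.inner_left_of_mem_orthogonal (K := T.ker) (hTB _)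
      (Submodule.sub_starProjection_mem_orthogonal x)
  have hBx : cfc q A x = cfc q A y := by
    rw [map_sub, sub_eq_zero] at hBz
    exact hBz
  have h1 : inner ℂ x (cfc q A x) = inner ℂ y (cfc q A y) := by
    rw [hBx, ← inner_cfc_comm, hBx, inner_cfc_comm]
  have h2 := re_inner_cfc_mono (A := A) (g := fun _ => 1) hq continuous_const (fun x _ => by
      simp only [q]
      refine max_le zero_le_one ?_
      have : 0 ≤ |x| / a := by positivity
      linarith) y
  rw [h1, re_inner_starProjection_eq, ← hy]
  refine h2.trans (le_of_eq ?_)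
  rw [cfc_const_one ℝ A, one_apply_eq_self, re_inner_self_eq]

/-- The spectral projections of an invertible operator vanish near zero. -/
lemma exists_spectralProj_eq_zero {A : H →L[ℂ] H} (hA : IsUnit A) :
    ∃ c > 0, ∀ b < c, spectralProj (absOp A) b = 0 := by
  have hunit : IsUnit (absOp A) := by
    have h : IsUnit (absOp A * absOp A) := by
      rw [absOp, CFC.abs_mul_abs]
      exact hA.star.mul hA
    exact ((Commute.refl _).isUnit_mul_iff.1 h).1
  have hnn : ∀ x ∈ spectrum ℝ (absOp A), 0 ≤ x := fun x hx =>
    spectrum_nonneg_of_nonneg (CFC.abs_nonneg A) hx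
  have h0 : (0 : ℝ) ∉ spectrum ℝ (absOp A) := by
    rwa [spectrum.zero_mem_iff, not_not]
  have hclosed : IsClosed (spectrum ℝ (absOp A)) := spectrum.isClosed _
  obtain ⟨c, hc, hball⟩ := Metric.isOpen_iff.1 hclosed.isOpen_compl 0 h0
  refine ⟨c, hc, fun b hb => ?_⟩
  have hinj : IsUnit (cfc (fun x : ℝ => max (x - b) 0) (absOp A)) := by
    have hsa : IsSelfAdjoint (absOp A) := (CFC.abs_nonneg A).isSelfAdjoint
    rw [isUnit_cfc_iff _ _ (by fun_prop)]
    intro x hx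
    have hxc : c ≤ x := by
      by_contra hcon
      refine hball ?_ hx
      rw [Metric.mem_ball, Real.dist_eq, sub_zero, abs_of_nonneg (hnn x hx)]
      exact not_le.1 hcon
    exact (lt_max_of_lt_left (by linarith)).ne'
  have hker : (cfc (fun x : ℝ => max (x - b) 0) (absOp A)).ker = ⊥ := by
    obtain ⟨u, hu⟩ := hinj
    rw [← hu, LinearMap.ker_eq_bot']
    intro x hx
    have : ((u⁻¹ : (H →L[ℂ] H)ˣ) * u : H →L[ℂ] H) x = 0 := by
      rw [mul_apply_eq_comp]
      exact (congrArg _ hx).trans (map_zero _)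
    simpa using this
  simp only [spectralProj, hker, Submodule.starProjection_bot]

end SpectralProjections

/-! ### Dyadic sums of spectral projections and their polynomial majorants. -/

section SpectralProjectionSums

variable {H : Type*} [NormedAddCommGroup H] [InnerProductSpace ℂ H] [CompleteSpace H]

lemma continuous_cutoff {b : ℝ} (hb : 0 < b) :
    Continuous fun x : ℝ => 1 - max (|x| - b) 0 / max b (|x| - b) :=
  continuous_const.sub (Continuous.div (by fun_prop) (by fun_prop) fun _ =>
    (hb.trans_le (le_max_left _ _)).ne')

/-- A continuous function that dominates a sum of indicator functions of spectral windows. -/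
def cutoffSum (K : ℕ) (a x : ℝ) : ℝ :=
  ∑ k ∈ Finset.range K,
    ((1 - max (|x| - 2 * (1 / 2) ^ k) 0 / max (2 * (1 / 2) ^ k) (|x| - 2 * (1 / 2) ^ k)) -
      max 0 (1 - |x| / a))

lemma continuous_cutoffSum (K : ℕ) (a : ℝ) : Continuous (cutoffSum K a) :=
  continuous_finsetSum _ fun k _ =>
    (continuous_cutoff (b := 2 * (1 / 2) ^ k) (by positivity)).sub (by fun_prop)

/-- Upper cutoffs bound the first projections and lower cutoffs the subtracted ones. The polynomial
majorant makes the bound a combination of moments of `A`. -/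
lemma sum_re_inner_spectralProj_le {A : H →L[ℂ] H} (hA : IsSelfAdjoint A) (K : ℕ) {a : ℝ}
    (ha : 0 < a) {q : Polynomial ℝ} (hq : ∀ x : ℝ, |x| ≤ ‖A‖ → cutoffSum K a x ≤ q.eval x)
    (x : H) :
    ∑ k ∈ Finset.range K, ((inner ℂ x (spectralProj (absOp A) (2 * (1 / 2) ^ k) x)).re -
        (inner ℂ x (spectralProj (absOp A) a x)).re) ≤
      ∑ j ∈ Finset.range (q.natDegree + 1), q.coeff j * (inner ℂ x ((A ^ j) x)).re := by
  have hc : Continuous fun x : ℝ => max 0 (1 - |x| / a) := by fun_prop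
  have hp : ∀ k : ℕ, Continuous fun x : ℝ =>
      1 - max (|x| - 2 * (1 / 2) ^ k) 0 / max (2 * (1 / 2) ^ k) (|x| - 2 * (1 / 2) ^ k) :=
    fun k => continuous_cutoff (by positivity)
  have h : cfc (cutoffSum K a) A = ∑ k ∈ Finset.range K,
      (cfc (fun x : ℝ => 1 - max (|x| - 2 * (1 / 2) ^ k) 0 /
        max (2 * (1 / 2) ^ k) (|x| - 2 * (1 / 2) ^ k)) A -
          cfc (fun x : ℝ => max 0 (1 - |x| / a)) A) := by
    have hsum : cutoffSum K a = ∑ k ∈ Finset.range K, fun x : ℝ =>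
        ((1 - max (|x| - 2 * (1 / 2) ^ k) 0 / max (2 * (1 / 2) ^ k) (|x| - 2 * (1 / 2) ^ k)) -
          max 0 (1 - |x| / a)) := by
      ext x
      simp only [cutoffSum, Finset.sum_apply]
    have hpc : ∀ k : ℕ, Continuous fun x : ℝ =>
        ((1 - max (|x| - 2 * (1 / 2) ^ k) 0 / max (2 * (1 / 2) ^ k) (|x| - 2 * (1 / 2) ^ k)) -
          max 0 (1 - |x| / a)) := fun k => (hp k).sub hc
    rw [hsum, cfc_sum _ A _ fun k _ => (hpc k).continuousOn]
    exact Finset.sum_congr rfl fun k _ => cfc_sub _ _ A (hp k).continuousOn hc.continuousOn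
  have hspec : ∀ y ∈ spectrum ℝ A, |y| ≤ ‖A‖ := fun y hy =>
    (spectrum.norm_le_norm_mul_of_mem hy).trans
      (mul_le_of_le_one_right (norm_nonneg _) ContinuousLinearMap.norm_id_le)
  calc _ ≤ (inner ℂ x (cfc (cutoffSum K a) A x)).re := by
        rw [h, sum_apply, inner_sum, Complex.re_sum]
        refine Finset.sum_le_sum fun k _ => ?_
        rw [sub_apply, inner_sub_right, Complex.sub_re]
        exact sub_le_sub (re_inner_spectralProj_le hA (by positivity) _)
          (le_re_inner_spectralProj hA ha _)
    _ ≤ (inner ℂ x (cfc q.eval A x)).re :=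
        re_inner_cfc_mono (continuous_cutoffSum K a) q.continuous
          (fun y hy => hq y (hspec y hy)) x
    _ = _ := by
        rw [cfc_polynomial q A hA, Polynomial.aeval_eq_sum_range, sum_apply,
          inner_sum, Complex.re_sum]
        refine Finset.sum_congr rfl fun j _ => ?_
        rw [smul_apply, inner_smul_right_eq_smul, Complex.real_smul, Complex.re_ofReal_mul]

end SpectralProjectionSums

/-- The function with which the sums of spectral projections near zero are compared grows at most
logarithmically. -/
lemma cutoffSum_le (K : ℕ) (a : ℝ) (x : ℝ) :
    cutoffSum K a x ≤ 3 + max 0 (-Real.log |x|) / Real.log 2 := by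
  unfold cutoffSum
  have hl2 : 0 < Real.log 2 := Real.log_pos one_lt_two
  -- For `k ≥ t` one has `|x| ≥ 4 * 2⁻ᵏ`, twice the cutoff level, where the upper cutoff is already
  -- zero. Rounding `t` up turns the `2` into the `3` of the bound.
  set t : ℝ := 2 + max 0 (-Real.log |x|) / Real.log 2 with ht
  have ht0 : 0 ≤ t := by positivity
  -- At zero both cutoffs equal one and cancel; this is how the kernel of a section drops out.
  by_cases hx : x = 0
  · subst hx
    simp
  have hx0 : 0 < |x| := abs_pos.2 hx
  have hterm : ∀ k ∈ Finset.range K,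
      ((1 - max (|x| - 2 * (1 / 2) ^ k) 0 / max (2 * (1 / 2) ^ k) (|x| - 2 * (1 / 2) ^ k)) -
        max 0 (1 - |x| / a)) ≤ if k < ⌈t⌉₊ then 1 else 0 := by
    intro k _
    set b : ℝ := 2 * (1 / 2) ^ k with hb
    have hb0 : 0 < b := by positivity
    have hq : 0 ≤ max 0 (1 - |x| / a) := le_max_left _ _
    have hr : 0 ≤ max (|x| - b) 0 / max b (|x| - b) :=
      div_nonneg (le_max_right _ _) (hb0.le.trans (le_max_left _ _))
    split_ifs with hk
    · linarith
    · have hkt : t ≤ k := (Nat.le_ceil t).trans (by exact_mod_cast not_lt.1 hk)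
      have hxb : 2 * b ≤ |x| := by
        rw [← Real.log_le_log_iff (by positivity) hx0, hb, ← mul_assoc, Real.log_mul
          (by norm_num) (by positivity), Real.log_pow, one_div, Real.log_inv,
          show (2 : ℝ) * 2 = 2 ^ 2 by norm_num, Real.log_pow]
        have h1 : (t - 2) * Real.log 2 = max 0 (-Real.log |x|) := by
          rw [ht]; field_simp; ring
        have h2 := le_max_right 0 (-Real.log |x|)
        push_cast
        nlinarith
      rw [max_eq_left (by linarith : (0 : ℝ) ≤ |x| - b), max_eq_right (by linarith),
        div_self (by linarith)]
      linarith
  refine (Finset.sum_le_sum hterm).trans ?_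
  rw [← Finset.sum_filter, Finset.sum_const, nsmul_eq_mul, mul_one]
  have hcard : ((Finset.range K).filter fun k => k < ⌈t⌉₊).card ≤ ⌈t⌉₊ := by
    refine (Finset.card_le_card (t := Finset.range ⌈t⌉₊) fun k hk => ?_).trans
      (Finset.card_range _).le
    exact Finset.mem_range.2 (Finset.mem_filter.1 hk).2
  have := Nat.ceil_lt_add_one ht0
  have hcard' : (((Finset.range K).filter fun k => k < ⌈t⌉₊).card : ℝ) ≤ ⌈t⌉₊ := by
    exact_mod_cast hcard
  linarith

/-! ### Spectral density near zero and positivity of the determinant. -/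

section VonNeumannTrace

variable {V : Type*}

lemma re_vnTrace (F : Finset V) (A : ℓ²(V, ℂ) →L[ℂ] ℓ²(V, ℂ)) :
    (vnTrace F A).re =
      ∑ v ∈ F, (inner ℂ (lp.single 2 v (1 : ℂ)) (A (lp.single 2 v (1 : ℂ)))).re := by
  rw [vnTrace, Complex.re_sum]

/-- Sums of values of the spectral density function near zero are bounded by the trace of a
polynomial in the operator that dominates a certain continuous function. -/
lemma sum_spectralDensity_le (F : Finset V) {A : ℓ²(V, ℂ) →L[ℂ] ℓ²(V, ℂ)}
    (hA : IsSelfAdjoint A) (K : ℕ) {a : ℝ} (ha : 0 < a) {q : Polynomial ℝ}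
    (hq : ∀ x : ℝ, |x| ≤ ‖A‖ → cutoffSum K a x ≤ q.eval x) :
    ∑ k ∈ Finset.range K,
        (spectralDensity F A (2 * (1 / 2) ^ k) - spectralDensity F A a) ≤
      (∑ j ∈ Finset.range (q.natDegree + 1), (q.coeff j : ℂ) * vnTrace F (A ^ j)).re := by
  simp only [spectralDensity, re_vnTrace, ← Finset.sum_sub_distrib, Complex.re_sum,
    Complex.re_ofReal_mul, Finset.mul_sum]
  rw [Finset.sum_comm]
  conv_rhs => rw [Finset.sum_comm]
  exact Finset.sum_le_sum fun v _ => sum_re_inner_spectralProj_le hA K ha hq _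

lemma fkDet_pos_of_sum_le (F : Finset V) (A : ℓ²(V, ℂ) →L[ℂ] ℓ²(V, ℂ)) {C : ℝ}
    (h : ∀ K : ℕ, ∀ a > 0, ∑ k ∈ Finset.range K,
      (spectralDensity F A (2 * (1 / 2) ^ k) - spectralDensity F A a) ≤ C) :
    0 < fkDet F A := by
  have hint := (spectralDensity_monotone F A).integrableOn_log_stieltjes h (‖A‖ + 1)
  unfold fkDet
  rw [if_pos (show IntegrableOn Real.log (Set.Ioc 0 (‖A‖ + 1)) (spectralDensityMeasure F A) from
    hint)]
  exact Real.exp_pos _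

/-- The Fuglede-Kadison determinant of an invertible operator is positive. -/
lemma fkDet_pos_of_isUnit (F : Finset V) {A : ℓ²(V, ℂ) →L[ℂ] ℓ²(V, ℂ)} (hA : IsUnit A) :
    0 < fkDet F A := by
  obtain ⟨c, hc, hP⟩ := exists_spectralProj_eq_zero hA
  have hG0 : ∀ b < c, spectralDensity F A b = 0 := by
    intro b hb
    simp [spectralDensity, vnTrace, hP b hb]
  have hmono := spectralDensity_monotone F A
  have hnn : ∀ b, 0 ≤ spectralDensity F A b := by
    intro b
    rcases lt_or_ge b c with hb | hb
    · exact (hG0 b hb).ge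
    · rw [← hG0 (c / 2) (by linarith)]
      exact hmono (by linarith)
  -- From index `n` on, `2 * 2⁻ᵏ` lies below the spectral gap `c`, so only the first `n` terms can
  -- be positive.
  obtain ⟨n, hn⟩ := exists_pow_lt_of_lt_one (half_pos hc) (one_half_lt_one (α := ℝ))
  refine fkDet_pos_of_sum_le F A (C := n * spectralDensity F A 2) fun K a _ => ?_
  have hterm : ∀ k ∈ Finset.range K,
      spectralDensity F A (2 * (1 / 2) ^ k) - spectralDensity F A a ≤
        if k < n then spectralDensity F A 2 else 0 := by
    intro k _
    have ha := hnn a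
    split_ifs with hk
    · have : spectralDensity F A (2 * (1 / 2) ^ k) ≤ spectralDensity F A 2 := by
        refine hmono ?_
        have : (1 / 2 : ℝ) ^ k ≤ 1 := pow_le_one₀ (by norm_num) (by norm_num)
        linarith
      linarith
    · rw [hG0]
      · linarith
      · have : (1 / 2 : ℝ) ^ k ≤ (1 / 2) ^ n :=
          pow_le_pow_of_le_one (by norm_num) (by norm_num) (not_lt.1 hk)
        linarith
  refine (Finset.sum_le_sum hterm).trans ?_
  rw [← Finset.sum_filter, Finset.sum_const, nsmul_eq_mul]
  refine mul_le_mul_of_nonneg_right ?_ (hnn 2)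
  have : ((Finset.range K).filter fun k => k < n).card ≤ n :=
    (Finset.card_le_card (t := Finset.range n) fun k hk =>
      Finset.mem_range.2 (Finset.mem_filter.1 hk).2).trans (Finset.card_range _).le
  exact_mod_cast this

end VonNeumannTrace

/-! ### From finite sections to the magnetic Laplacian on `ℓ²`. -/

namespace OrientedGraph

variable {V E : Type*} {X : OrientedGraph V E}

lemma coe_dml_sub_apply (hb : X.BoundedValence) (σ : X.WeightFunction) (c : ℂ)
    (f : ℓ²(V, ℂ)) :
    (((X.dml hb σ - c • 1 : ℓ²(V, ℂ) →L[ℂ] ℓ²(V, ℂ)) f : ℓ²(V, ℂ)) : V → ℂ) =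
      dmlSub σ c f := rfl

lemma coe_dml_sub_pow_apply (hb : X.BoundedValence) (σ : X.WeightFunction) (c : ℂ) (j : ℕ)
    (f : ℓ²(V, ℂ)) :
    ((((X.dml hb σ - c • 1 : ℓ²(V, ℂ) →L[ℂ] ℓ²(V, ℂ)) ^ j) f : ℓ²(V, ℂ)) : V → ℂ) =
      (dmlSub σ c ^ j) f := by
  induction j with
  | zero => rfl
  | succ j ih =>
    rw [pow_succ', pow_succ', mul_apply_eq_comp, Module.End.mul_apply, coe_dml_sub_apply, ih]

lemma coe_lp_single (v : V) : ((lp.single 2 v (1 : ℂ) : ℓ²(V, ℂ)) : V → ℂ) = Pi.single v 1 :=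
  lp.coeFn_single 2 v 1

lemma inner_single_single_dml_sub_pow (hb : X.BoundedValence) (σ : X.WeightFunction) (c : ℂ)
    (j : ℕ) (v w : V) :
    inner ℂ (lp.single 2 v (1 : ℂ))
      (((X.dml hb σ - c • 1 : ℓ²(V, ℂ) →L[ℂ] ℓ²(V, ℂ)) ^ j) (lp.single 2 w (1 : ℂ))) =
      (dmlSub σ c ^ j) (Pi.single w 1) v := by
  rw [lp.inner_single_left, coe_dml_sub_pow_apply, coe_lp_single]
  simp

lemma isSelfAdjoint_dml_sub (hb : X.BoundedValence) (σ : X.WeightFunction) (c : ℝ) :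
    IsSelfAdjoint (X.dml hb σ - (c : ℂ) • 1) := by
  set A : ℓ²(V, ℂ) →L[ℂ] ℓ²(V, ℂ) := X.dml hb σ - (c : ℂ) • 1 with hA
  rw [ContinuousLinearMap.isSelfAdjoint_iff']
  have hk : ∀ v w, inner ℂ (lp.single 2 v (1 : ℂ)) (A (lp.single 2 w (1 : ℂ))) =
      X.weightedKernel (fun e => (σ.toFun e : ℂ)) c v w := by
    intro v w
    rw [← dmlSub_single]
    have h := inner_single_single_dml_sub_pow hb σ c 1 v w
    rwa [pow_one, pow_one] at h
  -- Bounded operators are determined by point masses, so the Hermitian symmetry of the matrix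
  -- suffices.
  refine lp.ext_continuousLinearMap (by norm_num) fun w => ?_
  ext v
  have h1 : inner ℂ (lp.single 2 v (1 : ℂ))
      (ContinuousLinearMap.adjoint A (lp.single 2 w (1 : ℂ))) =
      inner ℂ (lp.single 2 v (1 : ℂ)) (A (lp.single 2 w (1 : ℂ))) := by
    rw [ContinuousLinearMap.adjoint_inner_right, ← inner_conj_symm, hk, hk, conj_weightedKernel]
  rw [lp.inner_single_left, lp.inner_single_left] at h1
  simpa using h1

/-- For algebraic `c` the sections of `Δ_σ - c` have eigenvalues that are bounded, and, as far as
they do not vanish, not too small on the average. -/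
lemma exists_eigenvalues_sectionMatrix (hb : X.BoundedValence) (σ : X.WeightFunction)
    (hrat : σ.IsRational) {c : ℝ} (hc : IsAlgebraic ℚ (c : ℂ)) :
    ∃ R C : ℝ, 1 ≤ R ∧ ∀ W : Finset V, ∃ l : W → ℝ,
      (∀ j, (sectionMatrix σ c W ^ j).trace = ∑ i, (l i : ℂ) ^ j) ∧ (∀ i, |l i| ≤ R) ∧
      -C * W.card ≤ ∑ i, Real.log |l i| := by
  obtain ⟨N, hN⟩ := hb
  obtain ⟨n, hn, hσn⟩ := hrat
  -- All `n`-th roots of unity and `c` generate a number field whose degree does not depend on `W`.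
  set S : Set ℂ := {z | z ^ n = 1} ∪ {(c : ℂ)} with hS
  have hSfin : S.Finite := by
    refine Set.Finite.union ?_ (Set.finite_singleton _)
    refine (Polynomial.nthRootsFinset n (1 : ℂ)).finite_toSet.subset fun z hz => ?_
    exact (Polynomial.mem_nthRootsFinset hn _).2 hz
  have hSint : ∀ x ∈ S, IsIntegral ℚ x := by
    rintro x (hx | rfl)
    · exact IsIntegral.of_pow hn (by rw [show x ^ n = 1 from hx]; exact isIntegral_one)
    · exact hc.isIntegral
  set K := IntermediateField.adjoin ℚ S
  have : Finite S := hSfin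
  have : FiniteDimensional ℚ K := IntermediateField.finiteDimensional_adjoin hSint
  have : NumberField K := { }
  set z : E → K := fun e => ⟨(σ.toFun e : ℂ), IntermediateField.subset_adjoin ℚ S
    (Or.inl (by exact_mod_cast congrArg (fun u : Circle => (u : ℂ)) (hσn e)))⟩ with hz
  set c' : K := ⟨(c : ℂ), IntermediateField.subset_adjoin ℚ S (Or.inr rfl)⟩ with hc'
  have hzn : ∀ e, z e ^ n = 1 := fun e => Subtype.ext
    (congrArg (fun u : Circle => (u : ℂ)) (hσn e))
  have hzint : ∀ e, IsIntegral ℤ (z e) := fun e =>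
    IsIntegral.of_pow hn (by rw [hzn]; exact isIntegral_one)
  have hcZ : IsAlgebraic ℤ (c : ℂ) := (IsFractionRing.isAlgebraic_iff ℤ ℚ ℂ).2 hc
  obtain ⟨b, hb0, hbint⟩ := hcZ.exists_integral_multiple
  have hbint' : IsIntegral ℤ ((b : K) * c') := by
    rw [← isIntegral_algebraMap_iff (algebraMap K ℂ).injective]
    simpa [zsmul_eq_mul] using hbint
  have hznorm : ∀ φ : K →ₐ[ℚ] ℂ, ∀ e, ‖φ (z e)‖ ≤ 1 := fun φ e =>
    (Complex.norm_eq_one_of_pow_eq_one (by rw [← map_pow, hzn, map_one]) hn.ne').le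
  -- The bound has to hold under every embedding: conjugates of the weights are again roots of
  -- unity, and the sum dominates every conjugate of `c`.
  set R : ℝ := 2 * N + ∑ φ : K →ₐ[ℚ] ℂ, ‖φ c'‖ + 1 with hR
  have hR1 : 1 ≤ R := by
    have : 0 ≤ ∑ φ : K →ₐ[ℚ] ℂ, ‖φ c'‖ := Finset.sum_nonneg fun _ _ => norm_nonneg _
    have : (0 : ℝ) ≤ 2 * N := by positivity
    linarith
  refine ⟨R, Module.finrank ℚ K * Real.log (|(b : ℝ)| * R * 2) + Real.log |(b : ℝ)|, hR1,
    fun W => ?_⟩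
  have key := Matrix.IsHermitian.exists_eigenvalues_of_isIntegral_smul
    (Matrix.of fun v w : W => X.weightedKernel z c' v w) hb0
    (fun v w => isIntegral_mul_weightedKernel hzint hbint' v.1 w.1) hR1
    (fun φ v => by
      have h1 := sum_norm_weightedKernel_le hN (hznorm φ) (φ c') W v
      have h2 : ‖φ c'‖ ≤ ∑ φ : K →ₐ[ℚ] ℂ, ‖φ c'‖ :=
        Finset.single_le_sum (f := fun φ : K →ₐ[ℚ] ℂ => ‖φ c'‖) (fun _ _ => norm_nonneg _)
          (Finset.mem_univ φ)
      calc ∑ w : W, ‖φ (X.weightedKernel z c' v w)‖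
          = ∑ w : W, ‖X.weightedKernel (fun e => φ (z e)) (φ c') v w‖ :=
            Finset.sum_congr rfl fun w _ =>
              congrArg _ (map_weightedKernel φ.toRingHom z c' v.1 w.1)
        _ = ∑ w ∈ W, ‖X.weightedKernel (fun e => φ (z e)) (φ c') v w‖ :=
            Finset.sum_coe_sort W fun w => ‖X.weightedKernel (fun e => φ (z e)) (φ c') v w‖
        _ ≤ R := by linarith)
    K.val (isHermitian_sectionMatrix σ c W) (by
      ext v w
      exact (map_weightedKernel K.val.toRingHom z c' v.1 w.1).symm)
  rw [Fintype.card_coe] at key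
  exact key

variable {Γ : Type*} [Group Γ] [MulAction Γ V] [MulAction Γ E]

/-- A bound for the spectral traces of the sections of `Δ_σ - c` carries over to the von Neumann
trace of `Δ_σ - c`. -/
lemma le_of_le_re_vnTrace_of_sum_le (hΓ : IsAmenableGroup Γ) (hX : X.IsFreeAction Γ)
    (F : X.FundamentalDomain Γ) (hb : X.BoundedValence) (σ : X.WeightFunction)
    (hσ : σ.IsWeaklyInvariant Γ) (c : ℝ) {g : ℝ → ℝ} (hg : Continuous g) {R R' C T : ℝ}
    (hT : ∀ q : Polynomial ℝ, (∀ x : ℝ, |x| ≤ R' → g x ≤ q.eval x) →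
      T ≤ (∑ j ∈ Finset.range (q.natDegree + 1), (q.coeff j : ℂ) *
        vnTrace F.verts ((X.dml hb σ - (c : ℂ) • 1) ^ j)).re)
    (h : ∀ L : Finset Γ, ∃ l : F.translates L → ℝ,
      (∀ j, (sectionMatrix σ c (F.translates L) ^ j).trace = ∑ i, (l i : ℂ) ^ j) ∧
      (∀ i, |l i| ≤ R) ∧ ∑ i, g (l i) ≤ C * L.card) : T ≤ C := by
  suffices hsuff : ∀ ε > 0, T ≤ C + ε * (2 * F.verts.card + 1) by
    refine le_of_forall_pos_le_add fun ε hε => ?_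
    have h1 := hsuff (ε / (2 * F.verts.card + 1)) (by positivity)
    rwa [div_mul_cancel₀ _ (by positivity)] at h1
  intro ε hε
  obtain ⟨p, hp⟩ := exists_polynomial_near_of_continuousOn (-max R R') (max R R') g
    hg.continuousOn ε hε
  -- Shifting the approximation up by `ε` makes it a majorant of `g` with excess at most `2 * ε`, on
  -- an interval containing both the section eigenvalues and the range required by `hT`.
  set q : Polynomial ℝ := p + Polynomial.C ε with hq
  have hq1 : ∀ x, |x| ≤ max R R' → g x ≤ q.eval x ∧ q.eval x ≤ g x + 2 * ε := by
    intro x hx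
    have h1 := abs_lt.1 (hp x (abs_le.1 hx))
    rw [hq, Polynomial.eval_add, Polynomial.eval_C]
    constructor <;> linarith
  set τ : ℕ → ℂ := fun j => ∑ v ∈ F.verts, (dmlSub σ c ^ j) (Pi.single v 1) v with hτ
  refine (hT q fun x hx => (hq1 x (hx.trans (le_max_right _ _))).1).trans ?_
  have hvn : ∀ j, vnTrace F.verts ((X.dml hb σ - (c : ℂ) • 1) ^ j) = τ j := fun j =>
    Finset.sum_congr rfl fun v _ => inner_single_single_dml_sub_pow hb σ c j v v
  simp only [hvn]
  set Q : ℝ := ∑ j ∈ Finset.range (q.natDegree + 1), |q.coeff j| with hQ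
  have hQ0 : 0 ≤ Q := Finset.sum_nonneg fun _ _ => abs_nonneg _
  obtain ⟨L, hL, hLtr⟩ := exists_norm_trace_sectionMatrix_pow_sub_le hΓ hX σ hσ c F
    (q.natDegree + 1) (ε := ε / (Q + 1)) (by positivity)
  obtain ⟨l, hltr, hlR, hlg⟩ := h L
  have hLpos : (0 : ℝ) < L.card := by exact_mod_cast hL.card_pos
  have hsum : ∑ j ∈ Finset.range (q.natDegree + 1),
      (q.coeff j : ℂ) * (sectionMatrix σ c (F.translates L) ^ j).trace =
      ((∑ i, q.eval (l i) : ℝ) : ℂ) := by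
    simp only [hltr, Finset.mul_sum]
    rw [Finset.sum_comm]
    push_cast
    refine Finset.sum_congr rfl fun i _ => ?_
    rw [Polynomial.eval_eq_sum_range]
    push_cast
    rfl
  have hqsum : ∑ i, q.eval (l i) ≤ C * L.card + L.card * F.verts.card * (2 * ε) := by
    calc ∑ i, q.eval (l i) ≤ ∑ i, (g (l i) + 2 * ε) :=
          Finset.sum_le_sum fun i _ => (hq1 _ ((hlR i).trans (le_max_left _ _))).2
      _ ≤ _ := by
          rw [Finset.sum_add_distrib, Finset.sum_const, Finset.card_univ, Fintype.card_coe,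
            FundamentalDomain.card_translates hX, nsmul_eq_mul]
          push_cast
          linarith
  have hdiff : ‖∑ j ∈ Finset.range (q.natDegree + 1), (q.coeff j : ℂ) *
      ((sectionMatrix σ c (F.translates L) ^ j).trace - L.card * τ j)‖ ≤ ε * L.card := by
    calc _ ≤ ∑ j ∈ Finset.range (q.natDegree + 1), |q.coeff j| * (ε / (Q + 1) * L.card) := by
          refine (norm_sum_le _ _).trans (Finset.sum_le_sum fun j hj => ?_)
          rw [norm_mul, Complex.norm_real, Real.norm_eq_abs]
          gcongr
          exact hLtr j (Finset.mem_range.1 hj)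
      _ = Q / (Q + 1) * (ε * L.card) := by rw [← Finset.sum_mul]; ring
      _ ≤ 1 * (ε * L.card) := by
          gcongr
          rw [div_le_one (by positivity)]
          linarith
      _ = ε * L.card := one_mul _
  have hsplit : ∑ j ∈ Finset.range (q.natDegree + 1), (q.coeff j : ℂ) *
      ((sectionMatrix σ c (F.translates L) ^ j).trace - L.card * τ j) =
      ((∑ i, q.eval (l i) : ℝ) : ℂ) -
        (L.card : ℝ) * ∑ j ∈ Finset.range (q.natDegree + 1), (q.coeff j : ℂ) * τ j := by
    rw [← hsum, Finset.mul_sum, ← Finset.sum_sub_distrib]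
    refine Finset.sum_congr rfl fun j _ => ?_
    push_cast
    ring
  rw [hsplit] at hdiff
  have hre := (neg_le_abs _).trans ((Complex.abs_re_le_norm _).trans hdiff)
  rw [Complex.sub_re, Complex.ofReal_re, Complex.re_ofReal_mul] at hre
  -- Per element of `L`, the excess of `q` costs `2 * ε` for each vertex of the domain, and the
  -- trace approximation costs another `ε`.
  refine le_of_mul_le_mul_left ?_ hLpos
  linarith

/-- The Fuglede-Kadison determinant of `Δ_σ - c` is positive for all real algebraic `c`. -/
lemma fkDet_dml_sub_pos (hΓ : IsAmenableGroup Γ) (hX : X.IsFreeAction Γ)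
    (F : X.FundamentalDomain Γ) (hb : X.BoundedValence) (σ : X.WeightFunction)
    (hσ : σ.IsWeaklyInvariant Γ) (hrat : σ.IsRational) {c : ℝ} (hc : IsAlgebraic ℚ (c : ℂ)) :
    0 < fkDet F.verts (X.dml hb σ - (c : ℂ) • 1) := by
  obtain ⟨R, C, hR1, hsec⟩ := exists_eigenvalues_sectionMatrix hb σ hrat hc
  have hl2 : 0 < Real.log 2 := Real.log_pos one_lt_two
  refine fkDet_pos_of_sum_le _ _ (C := F.verts.card * (3 + (Real.log R + C) / Real.log 2))
    fun K a ha => le_of_le_re_vnTrace_of_sum_le hΓ hX F hb σ hσ c (continuous_cutoffSum K a)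
      (R := R) (fun q hq => sum_spectralDensity_le _ (isSelfAdjoint_dml_sub hb σ c) K ha hq)
      fun L => ?_
  · obtain ⟨l, hl, hlR, hlog⟩ := hsec (F.translates L)
    refine ⟨l, hl, hlR, ?_⟩
    -- Adding `log R` compensates for eigenvalues of modulus above one, so the bound on the full
    -- logarithmic sum controls its negative part.
    have hmax : ∀ i, max 0 (-Real.log |l i|) ≤ Real.log R - Real.log |l i| := by
      intro i
      have hR0 := Real.log_nonneg hR1
      by_cases h0 : l i = 0
      · simpa [h0] using hR0
      · have := Real.log_le_log (abs_pos.2 h0) (hlR i)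
        exact max_le (by linarith) (by linarith)
    calc _ ≤ ∑ i, (3 + (Real.log R - Real.log |l i|) / Real.log 2) :=
          Finset.sum_le_sum fun i _ => (cutoffSum_le K a (l i)).trans (by gcongr; exact hmax i)
      _ = (F.translates L).card * (3 + Real.log R / Real.log 2) -
            (∑ i, Real.log |l i|) / Real.log 2 := by
          simp only [sub_div]
          rw [Finset.sum_add_distrib, Finset.sum_sub_distrib, Finset.sum_const, Finset.sum_const,
            Finset.card_univ, Fintype.card_coe, nsmul_eq_mul, nsmul_eq_mul, ← Finset.sum_div]
          ring
      _ ≤ (F.translates L).card * (3 + Real.log R / Real.log 2) -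
            (-C * (F.translates L).card) / Real.log 2 := by gcongr
      _ = F.verts.card * (3 + (Real.log R + C) / Real.log 2) * L.card := by
          rw [FundamentalDomain.card_translates hX]
          push_cast
          ring

end OrientedGraph

end

/-! ### The proposition. -/

theorem mainTheorem8 {Γ V E : Type*} [Group Γ] [MulAction Γ V] [MulAction Γ E]
    (hΓ : IsAmenableGroup Γ) (X : OrientedGraph V E) (hX : X.IsFreeAction Γ)
    (F : X.FundamentalDomain Γ) (σ : X.WeightFunction) (hσ : σ.IsWeaklyInvariant Γ)
    (hrat : σ.IsRational) (μ : ℂ)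
    (hμ : μ ∉ spectrum ℂ (X.dml (OrientedGraph.boundedValence hX F) σ) ∨
      μ = 0 ∨
      (IsAlgebraic ℚ μ ∧
        ∃ (S : Finset Γ) (Λ : ℕ → Finset Γ) (bc : OrientedGraph.BoundaryCondition),
          IsRegularExhaustion S Λ ∧
          ∀ m, μ ∉ spectrum ℂ (OrientedGraph.restrictedDml hX F σ (Λ m) bc))) :
    0 < fkDet F.verts (X.dml (OrientedGraph.boundedValence hX F) σ - μ • 1) := by
  have hsa : IsSelfAdjoint (X.dml (OrientedGraph.boundedValence hX F) σ) := by
    simpa using OrientedGraph.isSelfAdjoint_dml_sub (OrientedGraph.boundedValence hX F) σ 0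
  by_cases hspec : μ ∈ spectrum ℂ (X.dml (OrientedGraph.boundedValence hX F) σ)
  · have halg : IsAlgebraic ℚ μ := by
      rcases hμ with h | rfl | h
      · exact absurd hspec h
      · exact isAlgebraic_zero
      · exact h.1
    -- The sections are Hermitian only for a real shift, which self-adjointness provides.
    have hre : μ = (μ.re : ℂ) := hsa.mem_spectrum_eq_re hspec
    rw [hre] at halg ⊢
    exact OrientedGraph.fkDet_dml_sub_pos hΓ hX F _ σ hσ hrat halg
  · refine fkDet_pos_of_isUnit _ ?_
    have h := (spectrum.notMem_iff.1 hspec).neg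
    rwa [neg_sub, Algebra.algebraMap_eq_smul_one] at h
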